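/- **Theorem (Harer–Zagier recursion).** Let $N\ge 1$ be an integer and let $C_k=\frac{1}{k+1}\binom{2k}{k}$ denote the Catalan numbers. For $k\ge 1$, identify a pairing $\pi$ of $\{1,\dots,2k\}$ (a decomposition into blocks of size two) with the fixed-point-free involution exchanging the two elements of each block, let $\gamma=(1,2,\dots,2k)$ be the long cycle, let $\#(\sigma)$ be the number of cycles of a permutation $\sigma$ (fixed points included), and say that $\pi$ has genus $g$ if $\#(\gamma\pi)-k-1=-2g$. Let $\varepsilon_g(k)$ be the number of pairings of $\{1,\dots,2k\}$ of genus $g$. Define real numbers $b_k=b_k^{(N)}$ by $b_0=1$ and $$\sum_{g\ge 0}\varepsilon_g(k)\,N^{-2g}=C_k\,b_k\qquad(k\ge 1).$$ Then: 1. If $A_N$ is a GUE$(N)$ random matrix, that is, $A_N=\frac1{\sqrt N}(a_{ij})_{i,j=1}^N$ is selfadjoint almost surely, the entries $a_{ij}$ with $i\ge j$ are independent, each $a_{ii}$ is a standard real Gaussian variable, and each $a_{ij}$ with $i\ne j$ is a standard complex Gaussian variable (distributed as $(X+\mathrm{i}Y)/\sqrt2$ with $X,Y$ independent standard real Gaussian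 variables), then for every $k\ge 0$ the random variable $\operatorname{tr}(A_N^{2k})$ is integrable and $$\mathbb E\big[\operatorname{tr}(A_N^{2k})\big]=C_k\,b_k,$$ where $\operatorname{tr}=\frac1N\operatorname{Tr}$ is the normalized trace. 2. For all $k\ge 1$, $$b_{k+1}=b_k+\frac{k(k+1)}{4N^2}\,b_{k-1}.$$ -/

import Mathlib

open MeasureTheory ProbabilityTheory

namespace HarerZagier

/-- The pairings of `n` points. A decomposition of the points into blocks of size two is identified
with the permutation that exchanges the two elements of each block, that is, with an involution
without fixed points. -/
def pairings (n : ℕ) : Set (Equiv.Perm (Fin n)) :=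
  {π | ∀ i, π (π i) = i ∧ π i ≠ i}

/-- The number of cycles of a permutation, where fixed points count as cycles (of length one). -/
noncomputable def numCycles {n : ℕ} (σ : Equiv.Perm (Fin n)) : ℕ :=
  Nat.card (Quotient (Equiv.Perm.SameCycle.setoid σ))

/-- The pairing `π` of `2 * k` points has genus `g`, that is, `#(γπ) - k - 1 = -2 * g`, where
`γ = finRotate (2 * k)` is the long cycle `i ↦ i + 1` modulo `2 * k`. Meant for `1 ≤ k`. -/
def HasGenus (k : ℕ) (π : Equiv.Perm (Fin (2 * k))) (g : ℕ) : Prop :=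
  (numCycles (finRotate (2 * k) * π) : ℤ) - k - 1 = -2 * (g : ℤ)

/-- `ε_g(k)`, the number of pairings of `2 * k` points that have genus `g`. -/
noncomputable def genusCount (g k : ℕ) : ℕ :=
  Set.ncard {π | π ∈ pairings (2 * k) ∧ HasGenus k π g}

/-- There is no pairing of `2 * k` points of genus above `k`, so that the sum over all genera below
is a sum over `g ≤ k`. -/
theorem genusCount_eq_zero {g k : ℕ} (h : k < g) : genusCount g k = 0 := by
  have h0 : {π | π ∈ pairings (2 * k) ∧ HasGenus k π g} = ∅ := by
    ext π
    simp only [Set.mem_ofPred_eq, Set.mem_empty_iff_false, iff_false, not_and]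
    intro _ hg
    unfold HasGenus at hg
    omega
  rw [genusCount, h0, Set.ncard_empty]

/-- The sum of `ε_g(k) * N ^ (-2 * g)` over all `g ≥ 0`. -/
noncomputable def genusSum (N k : ℕ) : ℝ :=
  ∑ g ∈ Finset.range (k + 1), (genusCount g k : ℝ) * (N : ℝ) ^ (-2 * (g : ℤ))

theorem hasSum_genusSum (N k : ℕ) :
    HasSum (fun g : ℕ => (genusCount g k : ℝ) * (N : ℝ) ^ (-2 * (g : ℤ))) (genusSum N k) := by
  apply hasSum_sum_of_ne_finset_zero
  intro g hg
  rw [Finset.mem_range, not_lt] at hg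
  rw [genusCount_eq_zero (by omega)]
  simp

/-- The law of a standard real Gaussian variable, seen as a complex variable. -/
noncomputable def stdRealGaussian : Measure ℂ :=
  (gaussianReal 0 1).map (fun x : ℝ => (x : ℂ))

/-- The law of a standard complex Gaussian variable `(X + iY) / √2`, where `X` and `Y` are
independent standard real Gaussian variables. -/
noncomputable def stdComplexGaussian : Measure ℂ :=
  ((gaussianReal 0 1).prod (gaussianReal 0 1)).map
    (fun p : ℝ × ℝ => ((p.1 : ℂ) + Complex.I * (p.2 : ℂ)) / (Real.sqrt 2 : ℂ))

/-- The unnormalized `N × N` Gaussian matrix `(a i j)`: it is selfadjoint, the entries with `j ≤ i`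
are independent, and each entry is standard Gaussian, real on the diagonal and complex off it. -/
structure IsUnnormalizedGUE {Ω : Type*} [MeasurableSpace Ω] (P : Measure Ω) {N : ℕ}
    (a : Ω → Matrix (Fin N) (Fin N) ℂ) : Prop where
  isHermitian : ∀ᵐ ω ∂P, (a ω).IsHermitian
  indep : iIndepFun (fun (p : {p : Fin N × Fin N // p.2 ≤ p.1}) (ω : Ω) => a ω p.1.1 p.1.2) P
  law_diag : ∀ i, HasLaw (fun ω => a ω i i) stdRealGaussian P
  law_offDiag : ∀ i j, i ≠ j → HasLaw (fun ω => a ω i j) stdComplexGaussian P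

/-- A GUE(N) random matrix: `A = (1 / √N) (a i j)`. -/
def IsGUE {Ω : Type*} [MeasurableSpace Ω] (P : Measure Ω) {N : ℕ}
    (A : Ω → Matrix (Fin N) (Fin N) ℂ) : Prop :=
  ∃ a : Ω → Matrix (Fin N) (Fin N) ℂ, IsUnnormalizedGUE P a ∧
    ∀ ω, A ω = (1 / (Real.sqrt N : ℂ)) • a ω

/-- The normalized trace of an `N × N` matrix. -/
noncomputable def normTrace {N : ℕ} (M : Matrix (Fin N) (Fin N) ℂ) : ℂ :=
  (1 / (N : ℂ)) * M.trace

end HarerZagier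

/-! Both claims concern `gueMoment N k`, the expected trace of the `2 * k`-th power of the
unnormalized matrix. It is computed in two ways, all expectations being linear functionals on
polynomial rings until the end.

Combinatorially, Wick's formula (`gueExp_prod_X`) expands the trace over pairings `π`, and each `π`
contributes the number of index functions constant on the cycles of `γπ`, a power of `N`
(`gueMoment_eq_sum_pairings`).

Analytically, the moment is that of a power sum under the eigenvalue density, the squared
Vandermonde determinant times independent Gaussians. No change of variables is made: matrix traces
and power sums under this density satisfy the same loop equations, which have at most one solution
(`LoopEquations.eq`). Expanding the determinant in Hermite polynomials, orthogonality leaves a sum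
over `i < N` of moments of squared Hermite polynomials (`gueExp_trace_pow`). Divided by the Gaussian
moment, these are Delannoy numbers; their three-term recursion in `k`, which comes from the Hermite
equation, and their Pascal rule in `i` combine into a three-term recursion for the sum over `i`
(`sum_hermiteRatio_add_two`), hence for the moments (`gueMoment_add_two`). Catalan ratios turn it
into the recursion for `b`.

The recursion also shows that the moment is a polynomial in `N` with exponents at most `k + 1` and
of the same parity. Comparing with the sum over pairings gives every pairing a genus
(`exists_genus`), so that sum is `N ^ (k + 1)` times the genus sum. Finally
`IsUnnormalizedGUE.integral_eval` identifies the formal functional with the actual expectation. -/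

namespace HarerZagier

/-! ### Gaussian expectations as linear functionals, and integration by parts -/

/-- The moments of the standard real Gaussian law. -/
def gaussMoment : ℕ → ℂ
  | 0 => 1
  | 1 => 0
  | n + 2 => (n + 1) * gaussMoment n

theorem gaussMoment_succ (n : ℕ) : gaussMoment (n + 1) = n * gaussMoment (n - 1) := by
  cases n with
  | zero => simp [gaussMoment]
  | succ n => simp [gaussMoment]

/-- The linear functional on a polynomial ring with prescribed values on monomials. -/
noncomputable def monomialFunctional {σ : Type*} (w : (σ →₀ ℕ) → ℂ) : MvPolynomial σ ℂ →ₗ[ℂ] ℂ :=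
  (MvPolynomial.basisMonomials σ ℂ).constr ℂ w

@[simp]
theorem monomialFunctional_monomial {σ : Type*} (w : (σ →₀ ℕ) → ℂ) (m : σ →₀ ℕ) (c : ℂ) :
    monomialFunctional w (MvPolynomial.monomial m c) = c * w m := by
  have h : MvPolynomial.monomial m c = c • MvPolynomial.basisMonomials σ ℂ m := by
    simp [MvPolynomial.smul_monomial]
  rw [h, map_smul, monomialFunctional, Module.Basis.constr_basis, smul_eq_mul]

/-- Integration by parts for a functional follows from the case of monomials. -/
theorem monomialFunctional_X_mul {σ : Type*} {w : (σ →₀ ℕ) → ℂ} {i j : σ}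
    (h : ∀ m, w (m + Finsupp.single i 1) = m j * w (m - Finsupp.single j 1))
    (f : MvPolynomial σ ℂ) :
    monomialFunctional w (MvPolynomial.X i * f) =
      monomialFunctional w (MvPolynomial.pderiv j f) := by
  induction f using MvPolynomial.induction_on' with
  | monomial m c =>
    rw [MvPolynomial.pderiv_monomial, mul_comm, MvPolynomial.X, MvPolynomial.monomial_mul]
    simp only [monomialFunctional_monomial, mul_one, h, mul_assoc]
  | add p q hp hq => simp only [mul_add, map_add, hp, hq]

/-- The expectation of a polynomial in one standard real Gaussian variable. -/
noncomputable def gaussExp : Polynomial ℂ →ₗ[ℂ] ℂ :=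
  (Polynomial.basisMonomials ℂ).constr ℂ gaussMoment

open Polynomial in
theorem gaussExp_monomial (n : ℕ) (c : ℂ) :
    gaussExp (monomial n c) = c * gaussMoment n := by
  have h : monomial n c = c • Polynomial.basisMonomials ℂ n := by
    simp [Polynomial.smul_monomial]
  rw [h, map_smul, gaussExp, Module.Basis.constr_basis, smul_eq_mul]

open Polynomial in
theorem gaussExp_eq_sum {D : ℕ} {p : ℂ[X]} (h : p.natDegree < D) :
    gaussExp p = ∑ n ∈ Finset.range D, p.coeff n * gaussMoment n := by
  conv_lhs => rw [p.as_sum_range' D h]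
  simp [gaussExp_monomial]

open Polynomial in
theorem gaussExp_X_mul (f : ℂ[X]) : gaussExp (X * f) = gaussExp (derivative f) := by
  induction f using Polynomial.induction_on' with
  | monomial n c =>
    rw [X_mul_monomial, derivative_monomial, gaussExp_monomial, gaussExp_monomial,
      gaussMoment_succ, mul_assoc]
  | add p q hp hq => simp only [mul_add, map_add, hp, hq]

/-- The expectation of a polynomial in independent standard real Gaussian variables. -/
noncomputable def gaussExpPi (N : ℕ) : MvPolynomial (Fin N) ℂ →ₗ[ℂ] ℂ :=
  monomialFunctional fun m => ∏ i, gaussMoment (m i)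

theorem gaussExpPi_X_mul {N : ℕ} (i : Fin N) (f : MvPolynomial (Fin N) ℂ) :
    gaussExpPi N (MvPolynomial.X i * f) = gaussExpPi N (MvPolynomial.pderiv i f) := by
  refine monomialFunctional_X_mul (fun m => ?_) f
  rw [← Finset.mul_prod_erase _ _ (Finset.mem_univ i),
    ← Finset.mul_prod_erase _
      (fun l : Fin N => gaussMoment ((m - Finsupp.single i 1 : Fin N →₀ ℕ) l))
      (Finset.mem_univ i)]
  rw [← mul_assoc]
  congr 1
  · simp [gaussMoment_succ]
  · refine Finset.prod_congr rfl fun l hl => ?_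
    have hl' : i ≠ l := (Finset.ne_of_mem_erase hl).symm
    simp [Finsupp.single_eq_of_ne' hl']

/-- Independence of the variables in algebraic form: after expansion into monomials, the weight of a
monomial is a product over the variables. -/
theorem gaussExpPi_prod {N : ℕ} (p : Fin N → Polynomial ℂ) :
    gaussExpPi N (∏ i, Polynomial.aeval (MvPolynomial.X i) (p i)) = ∏ i, gaussExp (p i) := by
  obtain ⟨D, hD⟩ : ∃ D, ∀ i, (p i).natDegree < D :=
    ⟨(Finset.univ.sup fun i => (p i).natDegree) + 1, fun i =>
      Nat.lt_succ_of_le (Finset.le_sup (f := fun i => (p i).natDegree) (Finset.mem_univ i))⟩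
  have h1 : ∀ i, Polynomial.aeval (MvPolynomial.X i : MvPolynomial (Fin N) ℂ) (p i) =
      ∑ n ∈ Finset.range D, (p i).coeff n • MvPolynomial.X i ^ n := fun i =>
    Polynomial.aeval_eq_sum_range' (hD i) _
  simp only [h1, gaussExp_eq_sum (hD _), Finset.prod_univ_sum, map_sum]
  refine Finset.sum_congr rfl fun φ _ => ?_
  have h2 : ∏ i, ((p i).coeff (φ i) • (MvPolynomial.X i : MvPolynomial (Fin N) ℂ) ^ φ i) =
      MvPolynomial.monomial (Finsupp.equivFunOnFinite.symm φ) (∏ i, (p i).coeff (φ i)) := by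
    rw [Finset.prod_smul, MvPolynomial.monomial_eq, Finsupp.prod_fintype _ _ (by simp),
      MvPolynomial.smul_eq_C_mul]
    simp
  rw [h2, gaussExpPi, monomialFunctional_monomial, Finset.prod_mul_distrib]
  simp

/-- The positions on or below the diagonal of an `N × N` matrix. -/
abbrev LowerIndex (N : ℕ) := {p : Fin N × Fin N // p.2 ≤ p.1}

/-- The expectation of `z ^ m p.1 * conj z ^ m p.2` for an entry `z` of a Gaussian matrix. -/
noncomputable def entryMoment {N : ℕ} (m : Fin N × Fin N →₀ ℕ) (p : LowerIndex N) : ℂ :=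
  if p.1.1 = p.1.2 then gaussMoment (m p.1)
  else if m p.1 = m p.1.swap then ((m p.1).factorial : ℂ) else 0

/-- The expectation of a polynomial in the entries of an unnormalized Gaussian matrix. -/
noncomputable def gueExp (N : ℕ) : MvPolynomial (Fin N × Fin N) ℂ →ₗ[ℂ] ℂ :=
  monomialFunctional fun m => ∏ p, entryMoment m p

theorem gueExp_one (N : ℕ) : gueExp N 1 = 1 := by
  rw [gueExp, ← MvPolynomial.C_1, MvPolynomial.C_apply, monomialFunctional_monomial, one_mul]
  refine Finset.prod_eq_one fun p _ => ?_
  simp [entryMoment, gaussMoment]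

/-- The covariance pairs an entry only with its transpose, so integration by parts differentiates in
the swapped variable. This is the only property of the matrix law, besides normalization, that the
loop equations and Wick's formula need. -/
theorem gueExp_X_mul {N : ℕ} (q : Fin N × Fin N) (f : MvPolynomial (Fin N × Fin N) ℂ) :
    gueExp N (MvPolynomial.X q * f) = gueExp N (MvPolynomial.pderiv q.swap f) := by
  refine monomialFunctional_X_mul (fun m => ?_) f
  obtain ⟨p, hp⟩ : ∃ p : LowerIndex N, p.1 = q ∨ p.1 = q.swap := by
    rcases le_total q.2 q.1 with h | h
    · exact ⟨⟨q, h⟩, Or.inl rfl⟩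
    · exact ⟨⟨q.swap, h⟩, Or.inr rfl⟩
  rw [← Finset.mul_prod_erase _ _ (Finset.mem_univ p),
    ← Finset.mul_prod_erase _ (fun l => entryMoment (m - Finsupp.single q.swap 1) l)
      (Finset.mem_univ p), ← mul_assoc]
  congr 1
  · have hsw : ∀ r : Fin N × Fin N, r.1 ≠ r.2 → r ≠ r.swap := fun r hr h => hr (congrArg Prod.fst h)
    by_cases hd : q.1 = q.2
    · have h1 : q.swap = q := by ext <;> simp [hd]
      have h2 : p.1 = q := by rcases hp with h | h; exacts [h, h.trans h1]
      simp [entryMoment, h2, hd, h1, gaussMoment_succ]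
    · have h3 := hsw q hd
      rcases hp with h | h
      · simp only [entryMoment, h, hd, if_false, Finsupp.add_apply, Finsupp.tsub_apply,
          Finsupp.single_eq_same, Finsupp.single_eq_of_ne' h3, Finsupp.single_eq_of_ne h3,
          add_zero, tsub_zero]
        by_cases e : m q + 1 = m q.swap
        · rw [if_pos e, if_pos (by omega), ← e, Nat.factorial_succ]; push_cast; ring
        · rw [if_neg e]
          -- With truncated subtraction, `e'` can hold here only if `m q.swap = 0`, and then the
          -- factor in front vanishes.
          split_ifs with e'
          · have : m q.swap = 0 := by omega
            simp [this]
          · simp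
      · have hd' : ¬ q.swap.1 = q.swap.2 := fun h => hd h.symm
        simp only [entryMoment, h, hd', if_false, Finsupp.add_apply, Finsupp.tsub_apply,
          Prod.swap_swap,
          Finsupp.single_eq_same, Finsupp.single_eq_of_ne' h3, Finsupp.single_eq_of_ne h3,
          add_zero, tsub_zero]
        by_cases e : m q.swap = m q + 1
        · rw [if_pos e, if_pos (by omega), e, Nat.factorial_succ, Nat.add_sub_cancel]
          push_cast
          ring
        · rw [if_neg e]
          split_ifs with e'
          · have : m q.swap = 0 := by omega
            simp [this]
          · simp
  · refine Finset.prod_congr rfl fun l hl => ?_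
    have hl' : l ≠ p := Finset.ne_of_mem_erase hl
    have key : ∀ r : Fin N × Fin N, (r = q ∨ r = q.swap) → r ≠ l.1 ∧ r ≠ l.1.swap := by
      intro r hr
      have h0 : r = p.1 ∨ r = p.1.swap := by
        rcases hr with rfl | rfl <;> rcases hp with h | h <;> simp [h]
      have h1 : p.1 ≠ l.1 := fun h => hl' (Subtype.ext h.symm)
      have h2 : p.1 ≠ l.1.swap := by
        intro h
        apply h1
        have a := p.2
        have b := l.2
        have c : p.1.1 = l.1.2 := congrArg Prod.fst h
        have d : p.1.2 = l.1.1 := congrArg Prod.snd h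
        ext <;> simp only [Fin.le_def, Fin.ext_iff] at * <;> omega
      rcases h0 with rfl | rfl
      · exact ⟨h1, h2⟩
      · refine ⟨fun h => h2 ?_, fun h => h1 (Prod.swap_injective h)⟩
        rw [← h, Prod.swap_swap]
    have k1 := key q (Or.inl rfl)
    have k2 := key q.swap (Or.inr rfl)
    simp [entryMoment, Finsupp.single_eq_of_ne' k1.1, Finsupp.single_eq_of_ne' k1.2,
      Finsupp.single_eq_of_ne' k2.1, Finsupp.single_eq_of_ne' k2.2]

/-! ### Loop equations: uniqueness, and validity for matrix traces -/

section LoopEquations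
open MvPolynomial

/-- The derivation `∑ i, x i ^ m * ∂ / ∂ x i` in terms of the power sums. -/
noncomputable def powerSumDerivation (m : ℕ) :
    Derivation ℂ (MvPolynomial ℕ ℂ) (MvPolynomial ℕ ℂ) :=
  mkDerivation ℂ fun l => (l : ℂ) • X (m + l - 1)

/-- The loop equations (Schwinger-Dyson equations) of the Gaussian unitary ensemble, for the joint
moments of the traces of powers: the variable `X l` stands for the trace of the `l`-th power. -/
structure LoopEquations (N : ℕ) (Ψ : MvPolynomial ℕ ℂ →ₗ[ℂ] ℂ) : Prop where
  one : Ψ 1 = 1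
  X_zero_mul : ∀ f, Ψ (X 0 * f) = N * Ψ f
  X_succ_mul : ∀ m f, Ψ (X (m + 1) * f) =
    Ψ ((∑ a ∈ Finset.range m, X a * X (m - 1 - a)) * f) + Ψ (powerSumDerivation m f)

theorem powerSumDerivation_monomial (m : ℕ) (s : ℕ →₀ ℕ) :
    powerSumDerivation m (monomial s 1) =
      ∑ l ∈ s.support, ((s l : ℂ) * l) •
        monomial (s - Finsupp.single l 1 + Finsupp.single (m + l - 1) 1) 1 := by
  rw [powerSumDerivation, mkDerivation_monomial, one_smul, Finsupp.sum]
  refine Finset.sum_congr rfl fun l _ => ?_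
  rw [X, smul_eq_mul, mul_smul_comm, monomial_mul, smul_monomial, smul_monomial]
  simp [mul_comm]

/-- The loop equations determine the functional. -/
theorem LoopEquations.eq {N : ℕ} {Ψ Φ : MvPolynomial ℕ ℂ →ₗ[ℂ] ℂ} (hΨ : LoopEquations N Ψ)
    (hΦ : LoopEquations N Φ) : Ψ = Φ := by
  -- The weight of `X l` is `l + 1` rather than `l`, so that removing a factor `X 0` also lowers it;
  -- every term on the right of a loop equation that has a nonzero coefficient then has smaller
  -- weight.
  have key : ∀ n, ∀ s : ℕ →₀ ℕ, Finsupp.weight (fun l => l + 1) s = n →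
      Ψ (monomial s 1) = Φ (monomial s 1) := by
    have hws : ∀ r : ℕ, Finsupp.weight (fun l : ℕ => l + 1) (Finsupp.single r 1) = r + 1 :=
      fun r => by simp [Finsupp.weight_single]
    intro n
    induction n using Nat.strong_induction_on with
    | _ n ih =>
      intro s hs
      by_cases h0 : s = 0
      · subst h0
        have : monomial (0 : ℕ →₀ ℕ) (1 : ℂ) = 1 := rfl
        rw [this, hΨ.one, hΦ.one]
      obtain ⟨l, hl⟩ := Finsupp.ne_iff.1 h0
      have hl' : Finsupp.single l 1 ≤ s := Finsupp.single_le_iff.2 (Nat.one_le_iff_ne_zero.2 hl)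
      obtain ⟨t, rfl⟩ := exists_add_of_le hl'
      have hw : l + 1 + Finsupp.weight (fun l => l + 1) t = n := by
        rw [← hs, map_add, hws]
      have hX : monomial (Finsupp.single l 1 + t) (1 : ℂ) = X l * monomial t 1 := by
        rw [X, monomial_mul, one_mul]
      rw [hX]
      cases l with
      | zero => rw [hΨ.X_zero_mul, hΦ.X_zero_mul, ih _ (by omega) t rfl]
      | succ m =>
        rw [hΨ.X_succ_mul, hΦ.X_succ_mul, powerSumDerivation_monomial]
        congr 1
        · simp only [Finset.sum_mul, map_sum]
          refine Finset.sum_congr rfl fun a ha => ?_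
          have ha' := Finset.mem_range.1 ha
          simp only [X, monomial_mul, one_mul]
          refine ih _ ?_ _ rfl
          simp only [map_add, hws]
          omega
        · simp only [map_sum, map_smul]
          refine Finset.sum_congr rfl fun r hr => ?_
          -- For `r = 0` the index `m + r - 1` may be truncated, but the coefficient is zero.
          rcases Nat.eq_zero_or_pos r with rfl | hr0
          · simp
          congr 1
          refine ih _ ?_ _ rfl
          have hr1 : Finsupp.single r 1 ≤ t :=
            Finsupp.single_le_iff.2 (Nat.one_le_iff_ne_zero.2 (Finsupp.mem_support_iff.1 hr))
          obtain ⟨u, rfl⟩ := exists_add_of_le hr1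
          rw [add_tsub_cancel_left]
          simp only [map_add, hws] at hw ⊢
          omega
  refine LinearMap.ext fun f => ?_
  induction f using MvPolynomial.induction_on' with
  | monomial s c =>
    have : monomial s c = c • monomial s (1 : ℂ) := by rw [smul_monomial]; simp
    rw [this, map_smul, map_smul, key _ s rfl]
  | add p q hp hq => rw [map_add, map_add, hp, hq]

/-- Two derivations along the same algebra homomorphism agree if they agree on the variables. -/
theorem derivation_aeval_eq {ι A : Type*} [CommRing A] [Algebra ℂ A] (v : ι → A)
    (d : Derivation ℂ A A) (D : Derivation ℂ (MvPolynomial ι ℂ) (MvPolynomial ι ℂ))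
    (h : ∀ l, d (v l) = aeval v (D (X l))) (f : MvPolynomial ι ℂ) :
    d (aeval v f) = aeval v (D f) := by
  induction f using MvPolynomial.induction_on with
  | C c => simp [MvPolynomial.C_eq_smul_one]
  | add p q hp hq => simp only [map_add, hp, hq]
  | mul_X p l hp =>
    simp only [map_mul, Derivation.leibniz, aeval_X, smul_eq_mul, map_add, hp, h]

theorem derivation_sum_apply {ι A : Type*} [CommRing A] [Algebra ℂ A] (s : Finset ι)
    (d : ι → Derivation ℂ A A) (a : A) : (∑ i ∈ s, d i) a = ∑ i ∈ s, d i a :=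
  (congrFun (map_sum Derivation.coeFnAddMonoidHom d s) a).trans (Finset.sum_apply _ _ _)

section Matrix

/-- The generic `N × N` matrix. -/
noncomputable def genericMatrix (N : ℕ) :
    Matrix (Fin N) (Fin N) (MvPolynomial (Fin N × Fin N) ℂ) :=
  Matrix.of fun i j => X (i, j)

variable {N : ℕ}

/-- The noncommutative product rule: the derivative replaces one of the `m` factors by a matrix
unit, which cuts the power in two. -/
theorem pderiv_genericMatrix_pow (m : ℕ) (p q r s : Fin N) :
    pderiv (p, q) ((genericMatrix N ^ m) r s) =
      ∑ a ∈ Finset.range m,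
        (genericMatrix N ^ a) r p * (genericMatrix N ^ (m - 1 - a)) q s := by
  induction m generalizing s with
  | zero =>
    rcases eq_or_ne r s with rfl | h
    · simp
    · simp [Matrix.one_apply_ne h]
  | succ m ih =>
    have hX : ∀ t, pderiv (p, q) (genericMatrix N t s) =
        if t = p then (1 : Matrix (Fin N) (Fin N) (MvPolynomial (Fin N × Fin N) ℂ)) q s
        else 0 := by
      intro t
      rw [genericMatrix, Matrix.of_apply, pderiv_X, Matrix.one_apply, Pi.single_apply]
      simp only [Prod.mk.injEq]
      by_cases h1 : t = p <;> by_cases h2 : s = q <;> simp [h1, h2, eq_comm (a := q)]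
    rw [pow_succ, Matrix.mul_apply, map_sum, Finset.sum_range_succ]
    simp only [Derivation.leibniz, smul_eq_mul, ih, hX, Finset.sum_add_distrib]
    rw [add_comm]
    congr 1
    · simp only [Finset.mul_sum]
      rw [Finset.sum_comm]
      refine Finset.sum_congr rfl fun a ha => ?_
      have ha' := Finset.mem_range.1 ha
      have e : m + 1 - 1 - a = (m - 1 - a) + 1 := by omega
      rw [e, pow_succ, Matrix.mul_apply, Finset.mul_sum]
      exact Finset.sum_congr rfl fun t _ => by ring
    · simp

/-- The functional on power sums given by the traces of a Gaussian matrix. -/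
noncomputable def traceFunctional (N : ℕ) : MvPolynomial ℕ ℂ →ₗ[ℂ] ℂ :=
  (gueExp N).comp (aeval fun l => (genericMatrix N ^ l).trace).toLinearMap

/-- Each of the `l` places where a factor can be differentiated gives the same trace, by cyclicity.
-/
theorem pderiv_trace_genericMatrix (m l : ℕ) :
    ∑ i, ∑ j, (genericMatrix N ^ m) j i * pderiv (j, i) (genericMatrix N ^ l).trace =
      (l : ℂ) • (genericMatrix N ^ (m + l - 1)).trace := by
  have h : ∀ a ∈ Finset.range l,
      ∑ i, ∑ j, (genericMatrix N ^ m) j i *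
        ∑ r, (genericMatrix N ^ a) r j * (genericMatrix N ^ (l - 1 - a)) i r =
      (genericMatrix N ^ (m + l - 1)).trace := by
    intro a ha
    have ha' := Finset.mem_range.1 ha
    have e : m + l - 1 = m + (l - 1 - a + a) := by omega
    rw [e, pow_add, pow_add, Matrix.trace, Finset.sum_comm]
    simp only [Matrix.diag_apply, Matrix.mul_apply]
    refine Finset.sum_congr rfl fun j _ => Finset.sum_congr rfl fun i _ => ?_
    congr 1
    exact Finset.sum_congr rfl fun r _ => mul_comm _ _
  simp only [Matrix.trace, Matrix.diag_apply, map_sum, pderiv_genericMatrix_pow]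
  simp only [Finset.mul_sum] at h ⊢
  calc _ = ∑ a ∈ Finset.range l, ∑ i, ∑ j, ∑ r, (genericMatrix N ^ m) j i *
        ((genericMatrix N ^ a) r j * (genericMatrix N ^ (l - 1 - a)) i r) := by
        rw [Finset.sum_comm]
        conv_rhs => rw [Finset.sum_comm]; enter [2, i]; rw [Finset.sum_comm]
        rw [Finset.sum_comm]
        refine Finset.sum_congr rfl fun i _ => Finset.sum_congr rfl fun j _ => ?_
        rw [Finset.sum_comm]
    _ = _ := by
        rw [Finset.sum_congr rfl h]
        simp [Nat.cast_smul_eq_nsmul, Matrix.trace]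

theorem loopEquations_traceFunctional (N : ℕ) : LoopEquations N (traceFunctional N) where
  one := by simp [traceFunctional, gueExp_one]
  X_zero_mul f := by
    simp only [traceFunctional, LinearMap.comp_apply, AlgHom.toLinearMap_apply, map_mul, aeval_X]
    rw [pow_zero, Matrix.trace_one, Fintype.card_fin, ← nsmul_eq_mul, map_nsmul, nsmul_eq_mul]
  X_succ_mul m f := by
    simp only [traceFunctional, LinearMap.comp_apply, AlgHom.toLinearMap_apply, map_mul, aeval_X,
      map_sum]
    set F := aeval (fun l => (genericMatrix N ^ l).trace) f with hF
    -- One matrix factor is exposed for integration by parts. Its derivative falling on `M ^ m`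
    -- splits the trace into a product of two; falling on `F`, it gives `powerSumDerivation`.
    have h1 : (genericMatrix N ^ (m + 1)).trace * F =
        ∑ i, ∑ j, X (i, j) * ((genericMatrix N ^ m) j i * F) := by
      rw [pow_succ', Matrix.trace, Finset.sum_mul]
      simp only [Matrix.diag_apply, Matrix.mul_apply, Finset.sum_mul, mul_assoc]
      rfl
    have h2 : ∑ i, ∑ j, (genericMatrix N ^ m) j i * pderiv (j, i) F =
        aeval (fun l => (genericMatrix N ^ l).trace) (powerSumDerivation m f) := by
      have := derivation_aeval_eq (fun l => (genericMatrix N ^ l).trace)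
        (∑ i, ∑ j, (genericMatrix N ^ m) j i • pderiv (j, i)) (powerSumDerivation m)
        (fun l => by
          have := pderiv_trace_genericMatrix (N := N) m l
          simp only [derivation_sum_apply, Derivation.smul_apply, smul_eq_mul, powerSumDerivation,
            mkDerivation_X, map_smul, aeval_X, this]) f
      rw [← this]
      simp only [derivation_sum_apply, Derivation.smul_apply, smul_eq_mul, hF]
    rw [h1, ← h2, ← map_add]
    simp only [map_sum, gueExp_X_mul, Prod.swap_prod_mk, Derivation.leibniz, smul_eq_mul, map_add,
      Finset.sum_add_distrib]
    rw [add_comm]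
    congr 1
    simp only [pderiv_genericMatrix_pow, Finset.mul_sum, Finset.sum_mul, Matrix.trace,
      Matrix.diag_apply, map_sum]
    calc _ = ∑ a ∈ Finset.range m, ∑ i, ∑ j, gueExp N
          (F * ((genericMatrix N ^ a) j j * (genericMatrix N ^ (m - 1 - a)) i i)) := by
          rw [Finset.sum_comm]
          conv_rhs => rw [Finset.sum_comm]; enter [2, i]; rw [Finset.sum_comm]
          rw [Finset.sum_comm]
      _ = _ := by
          refine Finset.sum_congr rfl fun a _ => Finset.sum_congr rfl fun i _ =>
            Finset.sum_congr rfl fun j _ => congrArg _ (by ring)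

end Matrix

end LoopEquations

/-! ### The same loop equations for the eigenvalue density -/

section Eigenvalues
open MvPolynomial

section Vandermonde

variable {N : ℕ}

/-- The Vandermonde determinant of the variables. -/
noncomputable def vandermondeDet (N : ℕ) : MvPolynomial (Fin N) ℂ :=
  (Matrix.vandermonde (X : Fin N → MvPolynomial (Fin N) ℂ)).det

/-- The vector field `∑ i, x i ^ m * ∂ / ∂ x i`. -/
noncomputable def powerField (N m : ℕ) :
    Derivation ℂ (MvPolynomial (Fin N) ℂ) (MvPolynomial (Fin N) ℂ) :=
  ∑ i, (X i : MvPolynomial (Fin N) ℂ) ^ m • pderiv i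

theorem powerField_apply (m : ℕ) (f : MvPolynomial (Fin N) ℂ) :
    powerField N m f = ∑ i, X i ^ m * pderiv i f := by
  simp only [powerField, derivation_sum_apply, Derivation.smul_apply, smul_eq_mul]

theorem powerField_X (m : ℕ) (i : Fin N) : powerField N m (X i) = X i ^ m := by
  simp [powerField_apply, pderiv_X, Pi.single_apply]

theorem gaussExpPi_powerSum_mul (m : ℕ) (W : MvPolynomial (Fin N) ℂ) :
    gaussExpPi N ((∑ i, X i ^ (m + 1)) * W) =
      gaussExpPi N ((m : MvPolynomial (Fin N) ℂ) * (∑ i, X i ^ (m - 1)) * W +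
        powerField N m W) := by
  rw [powerField_apply, Finset.mul_sum, Finset.sum_mul, Finset.sum_mul,
    ← Finset.sum_add_distrib, map_sum, map_sum]
  refine Finset.sum_congr rfl fun i _ => ?_
  rw [pow_succ', mul_assoc, gaussExpPi_X_mul, Derivation.leibniz, Derivation.leibniz_pow,
    pderiv_X_self]
  congr 1
  simp only [smul_eq_mul, nsmul_eq_mul]
  ring

theorem derivation_prod_eigen {ι A : Type*} [CommRing A] [Algebra ℂ A] (d : Derivation ℂ A A)
    (s : Finset ι) (f c : ι → A) (h : ∀ i ∈ s, d (f i) = c i * f i) :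
    d (∏ i ∈ s, f i) = (∑ i ∈ s, c i) * ∏ i ∈ s, f i := by
  classical
  induction s using Finset.induction_on with
  | empty => simp
  | insert a s ha ih =>
    rw [Finset.prod_insert ha, Finset.sum_insert ha, Derivation.leibniz,
      h a (Finset.mem_insert_self _ _), ih fun i hi => h i (Finset.mem_insert_of_mem hi),
      smul_eq_mul, smul_eq_mul]
    ring

/-- The vector field multiplies each factor `X j - X i` by a symmetric divided difference. Twice the
sum over pairs `i < j` is the full double sum, a sum of products of power sums, minus its diagonal.
-/
theorem powerField_vandermondeDet (m : ℕ) :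
    2 * powerField N m (vandermondeDet N) =
      ((∑ a ∈ Finset.range m, (∑ i, X i ^ a) * ∑ i, X i ^ (m - 1 - a)) -
        (m : MvPolynomial (Fin N) ℂ) * ∑ i, X i ^ (m - 1)) * vandermondeDet N := by
  -- This is `(X j ^ m - X i ^ m) / (X j - X i)`, extended to `i = j` by `m * X i ^ (m - 1)`.
  let S : Fin N → Fin N → MvPolynomial (Fin N) ℂ := fun i j =>
    ∑ a ∈ Finset.range m, X j ^ a * X i ^ (m - 1 - a)
  have hS : ∀ i j, S i j = S j i := by
    intro i j
    simp only [S]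
    rw [← Finset.sum_range_reflect]
    refine Finset.sum_congr rfl fun a ha => ?_
    have := Finset.mem_range.1 ha
    rw [mul_comm]
    congr 2
    omega
  have h1 : powerField N m (vandermondeDet N) =
      (∑ i, ∑ j ∈ Finset.Ioi i, S i j) * vandermondeDet N := by
    rw [vandermondeDet, Matrix.det_vandermonde]
    refine derivation_prod_eigen _ _ _ _ fun i _ => derivation_prod_eigen _ _ _ _ fun j _ => ?_
    rw [map_sub, powerField_X, powerField_X, ← geom_sum₂_mul]
  have h2 : ∑ i, ∑ j, S i j = 2 * (∑ i, ∑ j ∈ Finset.Ioi i, S i j) + ∑ i, S i i := by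
    have h3 : ∑ i, ∑ j ∈ Finset.Iio i, S i j = ∑ i, ∑ j ∈ Finset.Ioi i, S i j := by
      simp only [Finset.sum_sigma']
      refine Finset.sum_bij' (fun p _ => ⟨p.2, p.1⟩) (fun p _ => ⟨p.2, p.1⟩) ?_ ?_ ?_ ?_ ?_
      · simp
      · simp
      · simp
      · simp
      · exact fun p _ => hS _ _
    have h4 : ∀ i, ∑ j, S i j = ∑ j ∈ Finset.Iio i, S i j + ∑ j ∈ Finset.Ioi i, S i j + S i i := by
      intro i
      rw [← Finset.sum_add_sum_compl (Finset.Iio i)]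
      have : (Finset.Iio i)ᶜ = insert i (Finset.Ioi i) := by
        ext j; simp [le_iff_eq_or_lt]
      rw [this, Finset.sum_insert (by simp)]
      ring
    simp only [h4, Finset.sum_add_distrib, h3]
    ring
  have h5 : ∑ i, ∑ j, S i j =
      ∑ a ∈ Finset.range m, (∑ i, (X i : MvPolynomial (Fin N) ℂ) ^ a) *
        ∑ i, X i ^ (m - 1 - a) := by
    simp only [S, Finset.sum_mul_sum]
    rw [Finset.sum_comm]
    conv_rhs => rw [Finset.sum_comm]; enter [2, i]; rw [Finset.sum_comm]
  have h6 : ∑ i, S i i = m * ∑ i, (X i : MvPolynomial (Fin N) ℂ) ^ (m - 1) := by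
    rw [Finset.mul_sum]
    refine Finset.sum_congr rfl fun i _ => ?_
    change ∑ a ∈ Finset.range m, _ = _
    rw [Finset.sum_congr rfl (g := fun _ => (X i : MvPolynomial (Fin N) ℂ) ^ (m - 1))]
    · simp
    · intro a ha
      have := Finset.mem_range.1 ha
      rw [← pow_add]
      congr 1
      omega
  rw [← h5, ← h6, h2, h1]
  ring

/-- The normalization constant of the eigenvalue density. -/
noncomputable def eigenvalueConst (N : ℕ) : ℂ := gaussExpPi N (vandermondeDet N ^ 2)

/-- The functional on power sums given by the eigenvalue density of the Gaussian unitary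
ensemble. -/
noncomputable def eigenvalueFunctional (N : ℕ) : MvPolynomial ℕ ℂ →ₗ[ℂ] ℂ :=
  (eigenvalueConst N)⁻¹ • (gaussExpPi N).comp
    ((LinearMap.mulLeft ℂ (vandermondeDet N ^ 2)).comp
      (aeval fun l => ∑ i, (X i : MvPolynomial (Fin N) ℂ) ^ l).toLinearMap)

theorem eigenvalueFunctional_apply (f : MvPolynomial ℕ ℂ) :
    eigenvalueFunctional N f = (eigenvalueConst N)⁻¹ *
      gaussExpPi N (vandermondeDet N ^ 2 *
        aeval (fun l => ∑ i, (X i : MvPolynomial (Fin N) ℂ) ^ l) f) := rfl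

theorem powerField_aeval (m : ℕ) (f : MvPolynomial ℕ ℂ) :
    powerField N m (aeval (fun l => ∑ i, (X i : MvPolynomial (Fin N) ℂ) ^ l) f) =
      aeval (fun l => ∑ i, (X i : MvPolynomial (Fin N) ℂ) ^ l) (powerSumDerivation m f) := by
  refine derivation_aeval_eq _ _ _ (fun l => ?_) f
  rw [powerSumDerivation, mkDerivation_X, map_smul, aeval_X, map_sum, Finset.smul_sum]
  refine Finset.sum_congr rfl fun i _ => ?_
  rw [Derivation.leibniz_pow, powerField_X, smul_eq_mul, ← pow_add, Nat.cast_smul_eq_nsmul]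
  rcases Nat.eq_zero_or_pos l with rfl | hl
  · simp
  · congr 2
    omega

theorem loopEquations_eigenvalueFunctional (h : eigenvalueConst N ≠ 0) :
    LoopEquations N (eigenvalueFunctional N) where
  one := by
    rw [eigenvalueFunctional_apply, map_one, mul_one]
    rw [← eigenvalueConst, inv_mul_cancel₀ h]
  X_zero_mul f := by
    simp only [eigenvalueFunctional_apply, map_mul, aeval_X, pow_zero, Finset.sum_const,
      Finset.card_univ, Fintype.card_fin, nsmul_eq_mul, mul_one]
    rw [mul_left_comm (vandermondeDet N ^ 2), ← nsmul_eq_mul, map_nsmul, nsmul_eq_mul]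
    ring
  X_succ_mul m f := by
    simp only [eigenvalueFunctional_apply, map_mul, aeval_X, map_sum]
    rw [← mul_add, ← map_add]
    refine congrArg _ ?_
    set F := aeval (fun l => ∑ i, (X i : MvPolynomial (Fin N) ℂ) ^ l) f with hF
    generalize hV : vandermondeDet N = V
    have h2 : V ^ 2 * ((∑ i, X i ^ (m + 1)) * F) = (∑ i, X i ^ (m + 1)) * (V ^ 2 * F) := by ring
    rw [h2, gaussExpPi_powerSum_mul, ← powerField_aeval, ← hF]
    refine congrArg _ ?_
    rw [Derivation.leibniz, Derivation.leibniz_pow]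
    have h3 := powerField_vandermondeDet (N := N) m
    rw [hV] at h3
    simp only [smul_eq_mul, nsmul_eq_mul]
    push_cast
    -- The square of the Vandermonde determinant supplies the factor 2 of `h3`, whose diagonal term
    -- cancels the one from differentiating `X i ^ m`.
    linear_combination (V * F) * h3

end Vandermonde

end Eigenvalues

/-! ### Hermite polynomials and their orthogonality -/

section Hermite
open Polynomial

/-- The Hermite polynomials with complex coefficients. -/
noncomputable def complexHermite (i : ℕ) : ℂ[X] := (hermite i).map (Int.castRingHom ℂ)

theorem complexHermite_zero : complexHermite 0 = 1 := by simp [complexHermite]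

theorem complexHermite_succ (i : ℕ) :
    complexHermite (i + 1) = X * complexHermite i - derivative (complexHermite i) := by
  simp [complexHermite, hermite_succ, derivative_map]

theorem natDegree_complexHermite (i : ℕ) : (complexHermite i).natDegree = i := by
  rw [complexHermite, (hermite_monic i).natDegree_map, natDegree_hermite]

theorem complexHermite_monic (i : ℕ) : (complexHermite i).Monic := (hermite_monic i).map _

theorem derivative_complexHermite_succ (i : ℕ) :
    derivative (complexHermite (i + 1)) = ((i : ℂ[X]) + 1) * complexHermite i := by
  induction i with
  | zero => simp [complexHermite_succ, complexHermite_zero]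
  | succ i ih =>
    have h : derivative (derivative (complexHermite (i + 1))) =
        ((i : ℂ[X]) + 1) * derivative (complexHermite i) := by
      rw [ih, derivative_mul]; simp
    rw [complexHermite_succ (i + 1), derivative_sub, derivative_mul, derivative_X, h, ih]
    rw [complexHermite_succ i]
    push_cast
    ring

/-- The differential equation of the Hermite polynomials. -/
theorem derivative_derivative_complexHermite (i : ℕ) :
    derivative (derivative (complexHermite i)) =
      X * derivative (complexHermite i) - (i : ℂ[X]) * complexHermite i := by
  have h := derivative_complexHermite_succ i
  rw [complexHermite_succ, derivative_sub, derivative_mul, derivative_X] at h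
  linear_combination -h

theorem gaussExp_complexHermite_succ_mul (i : ℕ) (q : ℂ[X]) :
    gaussExp (complexHermite (i + 1) * q) = gaussExp (complexHermite i * derivative q) := by
  rw [complexHermite_succ, sub_mul, map_sub, mul_assoc, gaussExp_X_mul, derivative_mul, map_add,
    add_sub_cancel_left]

/-- Integration by parts moves the raising operator off one factor, where it becomes a derivative
that lowers the other index. -/
theorem gaussExp_complexHermite_mul (i j : ℕ) :
    gaussExp (complexHermite i * complexHermite j) = if i = j then (i.factorial : ℂ) else 0 := by
  have h0 : ∀ j, gaussExp (complexHermite (j + 1) * complexHermite 0) = 0 := by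
    intro j
    rw [gaussExp_complexHermite_succ_mul, complexHermite_zero, derivative_one, mul_zero, map_zero]
  induction i generalizing j with
  | zero =>
    cases j with
    | zero =>
      have := gaussExp_monomial 0 1
      rw [monomial_zero_one] at this
      simp [complexHermite_zero, this, gaussMoment]
    | succ j => rw [mul_comm, h0]; simp
  | succ i ih =>
    cases j with
    | zero => rw [h0]; simp
    | succ j =>
      have : ((j : ℂ[X]) + 1) = C ((j : ℂ) + 1) := by simp
      rw [gaussExp_complexHermite_succ_mul, derivative_complexHermite_succ, this, mul_left_comm,
        ← smul_eq_C_mul, map_smul, ih, smul_eq_mul, Nat.factorial_succ]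
      by_cases h : i = j
      · subst h; simp
      · simp [h]

end Hermite

/-! ### Reduction of the eigenvalue density to squared Hermite polynomials -/

section Determinant

variable {N : ℕ}

/-- The monomials in the determinant may be replaced by any monic polynomials of the same degrees;
the Hermite polynomials make the expansion orthogonal. -/
theorem vandermondeDet_eq_sum (N : ℕ) : vandermondeDet N = ∑ σ : Equiv.Perm (Fin N),
    MvPolynomial.C ((Equiv.Perm.sign σ : ℤ) : ℂ) *
      ∏ i, Polynomial.aeval (MvPolynomial.X i) (complexHermite (σ i)) := by
  have h := Matrix.det_eval_matrixOfPolynomials_eq_det_vandermonde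
    (MvPolynomial.X : Fin N → MvPolynomial (Fin N) ℂ)
    (fun i => (complexHermite i).map MvPolynomial.C)
    (fun i => by rw [(complexHermite_monic i).natDegree_map, natDegree_complexHermite])
    (fun i => (complexHermite_monic i).map _)
  rw [vandermondeDet, h, ← Matrix.det_transpose, Matrix.det_apply']
  refine Finset.sum_congr rfl fun σ _ => ?_
  congr 1
  · simp
    refine Finset.prod_congr rfl fun i _ => ?_
    rw [Polynomial.eval_map, Polynomial.aeval_def]
    rfl

theorem gaussExpPi_vandermondeDet_sq_mul (q : Fin N → Polynomial ℂ) :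
    gaussExpPi N (vandermondeDet N ^ 2 * ∏ i, Polynomial.aeval (MvPolynomial.X i) (q i)) =
      ∑ σ : Equiv.Perm (Fin N), ∑ τ : Equiv.Perm (Fin N),
        ((Equiv.Perm.sign σ : ℤ) : ℂ) * ((Equiv.Perm.sign τ : ℤ) : ℂ) *
          ∏ i, gaussExp (complexHermite (σ i) * complexHermite (τ i) * q i) := by
  rw [pow_two, vandermondeDet_eq_sum, Finset.sum_mul_sum, Finset.sum_mul, map_sum]
  refine Finset.sum_congr rfl fun σ _ => ?_
  rw [Finset.sum_mul, map_sum]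
  refine Finset.sum_congr rfl fun τ _ => ?_
  rw [← gaussExpPi_prod]
  simp only [map_mul, Finset.prod_mul_distrib]
  rw [← smul_eq_mul (_ * _) (gaussExpPi N _), ← map_smul, MvPolynomial.smul_eq_C_mul,
    MvPolynomial.C_mul]
  refine congrArg _ ?_
  ring

theorem perm_eq_of_forall_ne {σ τ : Equiv.Perm (Fin N)} (j : Fin N)
    (h : ∀ i, i ≠ j → σ i = τ i) : σ = τ := by
  have h1 : τ⁻¹ * σ = 1 := by
    have h2 : ∀ i, i ≠ j → (τ⁻¹ * σ) i = i := fun i hi => by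
      rw [Equiv.Perm.mul_apply, h i hi, Equiv.Perm.inv_def, Equiv.symm_apply_apply]
    ext1 i
    by_cases hi : i = j
    · subst hi
      by_contra hne
      have h3 := h2 _ hne
      exact hne ((τ⁻¹ * σ).injective h3)
    · exact h2 i hi
  rw [inv_mul_eq_one] at h1
  exact h1.symm

/-- A sum of one-variable test functions against the squared Vandermonde determinant. -/
theorem gaussExpPi_vandermondeDet_sq_mul_single (j : Fin N) (p : Polynomial ℂ) :
    gaussExpPi N (vandermondeDet N ^ 2 * Polynomial.aeval (MvPolynomial.X j) p) =
      (∏ i : Fin N, ((i : ℕ).factorial : ℂ)) * ∑ σ : Equiv.Perm (Fin N),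
        gaussExp (complexHermite (σ j) ^ 2 * p) / ((σ j : ℕ).factorial : ℂ) := by
  have h0 : ∏ i, Polynomial.aeval (MvPolynomial.X i : MvPolynomial (Fin N) ℂ)
      (Function.update (1 : Fin N → Polynomial ℂ) j p i) =
        Polynomial.aeval (MvPolynomial.X j) p := by
    rw [Finset.prod_eq_single j]
    · simp
    · intro i _ hi; simp [Function.update_of_ne hi]
    · simp
  rw [← h0, gaussExpPi_vandermondeDet_sq_mul, Finset.mul_sum]
  refine Finset.sum_congr rfl fun σ _ => ?_
  -- Orthogonality in the variables other than `j` forces `τ` to agree with `σ` there, hence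
  -- everywhere.
  rw [Finset.sum_eq_single σ]
  · have h1 : ((Equiv.Perm.sign σ : ℤ) : ℂ) * ((Equiv.Perm.sign σ : ℤ) : ℂ) = 1 := by
      rw [← Int.cast_mul, ← Units.val_mul, Int.units_mul_self]; simp
    rw [h1, one_mul, ← Equiv.prod_comp σ (fun i : Fin N => ((i : ℕ).factorial : ℂ)),
      ← Finset.mul_prod_erase _ _ (Finset.mem_univ j),
      ← Finset.mul_prod_erase _ (fun i => ((σ i : ℕ).factorial : ℂ)) (Finset.mem_univ j)]
    have h2 : ∀ i ∈ Finset.univ.erase j, gaussExp (complexHermite (σ i) * complexHermite (σ i) *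
        Function.update (1 : Fin N → Polynomial ℂ) j p i) = ((σ i : ℕ).factorial : ℂ) := by
      intro i hi
      rw [Function.update_of_ne (Finset.ne_of_mem_erase hi), Pi.one_apply, mul_one,
        gaussExp_complexHermite_mul, if_pos rfl]
    rw [Finset.prod_congr rfl h2, Function.update_self, ← pow_two]
    have := Nat.cast_ne_zero (R := ℂ).2 (Nat.factorial_ne_zero (σ j : ℕ))
    field_simp
  · intro τ _ hτ
    obtain ⟨i, hi, hne⟩ : ∃ i, i ≠ j ∧ σ i ≠ τ i := by
      by_contra! h
      exact hτ (perm_eq_of_forall_ne j h).symm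
    rw [Finset.prod_eq_zero (Finset.mem_univ i), mul_zero]
    rw [Function.update_of_ne hi, Pi.one_apply, mul_one, gaussExp_complexHermite_mul, if_neg]
    exact fun h => hne (Fin.ext h)
  · simp

theorem sum_perm_apply (φ : Fin N → ℂ) :
    ∑ j, ∑ σ : Equiv.Perm (Fin N), φ (σ j) = (N.factorial : ℂ) * ∑ i, φ i := by
  rw [Finset.sum_comm]
  simp only [Equiv.sum_comp]
  simp [Fintype.card_perm]

theorem gaussExpPi_vandermondeDet_sq_mul_sum (p : Polynomial ℂ) :
    gaussExpPi N (vandermondeDet N ^ 2 * ∑ j, Polynomial.aeval (MvPolynomial.X j) p) =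
      (∏ i : Fin N, ((i : ℕ).factorial : ℂ)) * (N.factorial : ℂ) * ∑ i : Fin N,
        gaussExp (complexHermite i ^ 2 * p) / ((i : ℕ).factorial : ℂ) := by
  rw [Finset.mul_sum, map_sum, mul_assoc,
    ← sum_perm_apply fun i : Fin N =>
      gaussExp (complexHermite i ^ 2 * p) / ((i : ℕ).factorial : ℂ), Finset.mul_sum]
  exact Finset.sum_congr rfl fun j _ => gaussExpPi_vandermondeDet_sq_mul_single j p

theorem gaussExp_complexHermite_sq_div (i : ℕ) :
    gaussExp (complexHermite i ^ 2) / (i.factorial : ℂ) = 1 := by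
  rw [pow_two, gaussExp_complexHermite_mul, if_pos rfl]
  exact div_self (Nat.cast_ne_zero.2 (Nat.factorial_ne_zero _))

/-- The test function 1, summed over the `N` variables, gives `N` times this identity; hence the
hypothesis. -/
theorem eigenvalueConst_eq (hN : N ≠ 0) :
    eigenvalueConst N = (∏ i : Fin N, ((i : ℕ).factorial : ℂ)) * (N.factorial : ℂ) := by
  have h := gaussExpPi_vandermondeDet_sq_mul_sum (N := N) 1
  have hN' : (N : ℂ) ≠ 0 := Nat.cast_ne_zero.2 hN
  simp only [map_one, Finset.sum_const, Finset.card_univ, Fintype.card_fin, mul_one,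
    gaussExp_complexHermite_sq_div] at h
  rw [mul_smul_comm, map_nsmul, mul_one] at h
  rw [eigenvalueConst]
  simp only [nsmul_eq_mul, mul_one] at h
  refine mul_left_cancel₀ hN' ?_
  rw [h, mul_comm]

/-- Both functionals solve the loop equations, so they agree on the single power sum `X k`; on the
eigenvalue side all variables but one integrate out. -/
theorem gueExp_trace_pow (hN : N ≠ 0) (k : ℕ) :
    gueExp N (genericMatrix N ^ k).trace =
      ∑ i ∈ Finset.range N,
        gaussExp (Polynomial.X ^ k * complexHermite i ^ 2) / (i.factorial : ℂ) := by
  have hc : eigenvalueConst N ≠ 0 := by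
    rw [eigenvalueConst_eq hN]
    refine mul_ne_zero (Finset.prod_ne_zero_iff.2 fun i _ => ?_) ?_ <;>
    exact Nat.cast_ne_zero.2 (Nat.factorial_ne_zero _)
  have h := LinearMap.congr_fun ((loopEquations_traceFunctional N).eq
    (loopEquations_eigenvalueFunctional hc)) (MvPolynomial.X k)
  rw [eigenvalueFunctional_apply, traceFunctional, LinearMap.comp_apply,
    AlgHom.toLinearMap_apply, MvPolynomial.aeval_X, MvPolynomial.aeval_X] at h
  have h2 := gaussExpPi_vandermondeDet_sq_mul_sum (N := N) (Polynomial.X ^ k)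
  simp only [map_pow, Polynomial.aeval_X] at h2
  rw [h, h2, ← eigenvalueConst_eq hN, inv_mul_cancel_left₀ hc,
    Fin.sum_univ_eq_sum_range (fun i =>
      gaussExp (complexHermite i ^ 2 * Polynomial.X ^ k) / (i.factorial : ℂ))]
  exact Finset.sum_congr rfl fun i _ => by rw [mul_comm]

end Determinant

/-! ### Recursions for the Hermite moments and for the matrix moments -/

section Recursion
open Polynomial

theorem gaussExp_natCast_mul (n : ℕ) (p : ℂ[X]) :
    gaussExp ((n : ℂ[X]) * p) = n * gaussExp p := by
  rw [← nsmul_eq_mul, map_nsmul, nsmul_eq_mul]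

theorem gaussExp_X_pow_mul (n : ℕ) (p : ℂ[X]) : gaussExp (X ^ (n + 2) * p) =
    (n + 1) * gaussExp (X ^ n * p) + gaussExp (X ^ (n + 1) * derivative p) := by
  rw [pow_succ', mul_assoc, gaussExp_X_mul, derivative_mul, derivative_X_pow, map_add,
    C_eq_natCast, mul_assoc, gaussExp_natCast_mul]
  push_cast
  simp

/-- A three term recursion for the Gaussian moments of the square of a solution of the Hermite
differential equation. -/
theorem gaussExp_X_pow_mul_sq {i : ℕ} {h : ℂ[X]}
    (hode : derivative (derivative h) = X * derivative h - (i : ℂ[X]) * h) (m : ℕ) :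
    ((m : ℂ) + 4) * gaussExp (X ^ (m + 4) * h ^ 2) =
      (m + 3) * (4 * i + 2) * gaussExp (X ^ (m + 2) * h ^ 2) +
        (m + 3) * (m + 2) * (m + 1) * gaussExp (X ^ m * h ^ 2) := by
  have ht : ∀ n : ℕ, gaussExp (X ^ (n + 2) * h ^ 2) = (n + 1) * gaussExp (X ^ n * h ^ 2) +
      2 * gaussExp (X ^ (n + 1) * (h * derivative h)) := by
    intro n
    have h1 := gaussExp_X_pow_mul n (h ^ 2)
    have h2 : X ^ (n + 1) * derivative (h ^ 2) =
        ((2 : ℕ) : ℂ[X]) * (X ^ (n + 1) * (h * derivative h)) := by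
      rw [pow_two, derivative_mul]; push_cast; ring
    rw [h1, h2, gaussExp_natCast_mul, Nat.cast_ofNat]
  have hr : ∀ n : ℕ, gaussExp (X ^ (n + 1) * derivative h ^ 2) =
      i * gaussExp (X ^ (n + 1) * h ^ 2) -
        (n + 1) * gaussExp (X ^ n * (h * derivative h)) := by
    intro n
    have h1 := gaussExp_X_pow_mul n (h * derivative h)
    have h2 : X ^ (n + 1) * derivative (h * derivative h) =
        X ^ (n + 1) * derivative h ^ 2 + X ^ (n + 2) * (h * derivative h) -
          (i : ℂ[X]) * (X ^ (n + 1) * h ^ 2) := by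
      rw [derivative_mul, hode]; ring
    rw [h2, map_sub, map_add, gaussExp_natCast_mul] at h1
    linear_combination -h1
  have hrr : ∀ n : ℕ, gaussExp (X ^ (n + 2) * derivative h ^ 2) =
      2 * i * gaussExp (X ^ (n + 1) * (h * derivative h)) -
        (n + 1) * gaussExp (X ^ n * derivative h ^ 2) := by
    intro n
    have h1 := gaussExp_X_pow_mul n (derivative h ^ 2)
    have h2 : X ^ (n + 1) * derivative (derivative h ^ 2) =
        ((2 : ℕ) : ℂ[X]) * (X ^ (n + 2) * derivative h ^ 2) -
          ((2 * i : ℕ) : ℂ[X]) * (X ^ (n + 1) * (h * derivative h)) := by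
      rw [pow_two, derivative_mul, hode]; push_cast; ring
    rw [h2, map_sub, gaussExp_natCast_mul, gaussExp_natCast_mul] at h1
    push_cast at h1
    linear_combination -h1
  -- Five relations eliminate the four auxiliary moments: those of `h * derivative h` against powers
  -- `m + 1`, `m + 3` and of `derivative h ^ 2` against `m + 2`, `m + 4`.
  have e1 := hr (m + 3)
  have e2 := hrr (m + 2)
  have e3 := hr (m + 1)
  have f1 := ht (m + 2)
  have f2 := ht m
  simp only [add_assoc, Nat.reduceAdd] at e1 e2 e3 f1 f2
  push_cast at e1 e2 e3 f1 f2
  linear_combination -2 * (e2 - e1) + 2 * ((m : ℂ) + 3) * e3 + (2 * (i : ℂ) + m + 4) * f1 +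
    ((m : ℂ) + 3) * (m + 2) * f2

/-- The number by which the Gaussian moment of order `2 * k` is multiplied for a squared Hermite
function of index `i` in place of a Gaussian density. -/
noncomputable def hermiteRatio (k i : ℕ) : ℂ :=
  gaussExp (X ^ (2 * k) * complexHermite i ^ 2) / (i.factorial : ℂ) / gaussMoment (2 * k)

theorem gaussMoment_two_mul_ne_zero (k : ℕ) : gaussMoment (2 * k) ≠ 0 := by
  induction k with
  | zero => simp [gaussMoment]
  | succ k ih =>
    rw [Nat.mul_succ, gaussMoment]
    refine mul_ne_zero ?_ ih
    exact_mod_cast Nat.succ_ne_zero (2 * k)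

theorem gaussMoment_two_mul_succ (k : ℕ) :
    gaussMoment (2 * (k + 1)) = (2 * k + 1) * gaussMoment (2 * k) := by
  rw [Nat.mul_succ, gaussMoment]; push_cast; rfl

theorem hermiteRatio_zero (i : ℕ) : hermiteRatio 0 i = 1 := by
  rw [hermiteRatio, mul_zero, pow_zero, one_mul, gaussExp_complexHermite_sq_div]
  simp [gaussMoment]

theorem hermiteRatio_one (i : ℕ) : hermiteRatio 1 i = 2 * i + 1 := by
  have h1 := gaussExp_X_pow_mul 0 (complexHermite i ^ 2)
  -- Multiplication by `X` is the raising operator plus the derivative, so orthogonality evaluates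
  -- both terms.
  have h2 : X ^ (0 + 1) * derivative (complexHermite i ^ 2) =
      ((2 : ℕ) : ℂ[X]) * (complexHermite (i + 1) * derivative (complexHermite i) +
        derivative (complexHermite i) ^ 2) := by
    rw [pow_two, derivative_mul, complexHermite_succ]; push_cast; ring
  have h3 : gaussExp (derivative (complexHermite i) ^ 2) = i * (i.factorial : ℂ) := by
    cases i with
    | zero => simp [complexHermite_zero]
    | succ i =>
      have : (derivative (complexHermite (i + 1))) ^ 2 =
          (((i + 1) ^ 2 : ℕ) : ℂ[X]) * (complexHermite i * complexHermite i) := by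
        rw [derivative_complexHermite_succ]; push_cast; ring
      rw [this, gaussExp_natCast_mul, gaussExp_complexHermite_mul, if_pos rfl, Nat.factorial_succ]
      push_cast; ring
  have h4 : gaussExp (complexHermite (i + 1) * derivative (complexHermite i)) = 0 := by
    cases i with
    | zero => simp [complexHermite_zero]
    | succ i =>
      have : complexHermite (i + 1 + 1) * derivative (complexHermite (i + 1)) =
          ((i + 1 : ℕ) : ℂ[X]) * (complexHermite (i + 1 + 1) * complexHermite i) := by
        rw [derivative_complexHermite_succ]; push_cast; ring
      rw [this, gaussExp_natCast_mul, gaussExp_complexHermite_mul, if_neg (by omega), mul_zero]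
  have h5 := gaussExp_complexHermite_sq_div i
  have hf : (i.factorial : ℂ) ≠ 0 := Nat.cast_ne_zero.2 (Nat.factorial_ne_zero _)
  rw [h2, gaussExp_natCast_mul, map_add, h3, h4, pow_zero, one_mul] at h1
  rw [div_eq_one_iff_eq hf] at h5
  rw [h5] at h1
  rw [hermiteRatio, mul_one]
  simp only [zero_add] at h1
  rw [h1]
  simp only [gaussMoment]
  field_simp
  push_cast
  ring

/-- Dividing by the Gaussian moment removes the odd factors `2 * k + 1` and `2 * k + 3` from
`gaussExp_X_pow_mul_sq`. -/
theorem hermiteRatio_add_two (k i : ℕ) :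
    ((k : ℂ) + 2) * hermiteRatio (k + 2) i =
      (2 * i + 1) * hermiteRatio (k + 1) i + (k + 1) * hermiteRatio k i := by
  have h := gaussExp_X_pow_mul_sq (derivative_derivative_complexHermite i) (2 * k)
  have hf : (i.factorial : ℂ) ≠ 0 := Nat.cast_ne_zero.2 (Nat.factorial_ne_zero _)
  have hg := gaussMoment_two_mul_ne_zero k
  have h1 : (2 * (k : ℂ) + 1) ≠ 0 := by exact_mod_cast Nat.succ_ne_zero (2 * k)
  have h2 : (2 * (k : ℂ) + 3) ≠ 0 := by exact_mod_cast Nat.succ_ne_zero (2 * k + 2)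
  have e1 := gaussMoment_two_mul_succ k
  have e2 := gaussMoment_two_mul_succ (k + 1)
  rw [e1] at e2
  push_cast at e2 h
  have e2' : gaussMoment (2 * (k + 2)) = (2 * k + 3) * ((2 * k + 1) * gaussMoment (2 * k)) := by
    rw [e2]; ring
  simp only [hermiteRatio]
  rw [e1, e2']
  have a1 : 2 * (k + 2) = 2 * k + 4 := by ring
  have a2 : 2 * (k + 1) = 2 * k + 2 := by ring
  rw [a1, a2]
  generalize hu : 2 * (k : ℂ) + 1 = u at *
  generalize hv : 2 * (k : ℂ) + 3 = v at *
  field_simp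
  linear_combination h / 2

/-- The Pascal type recursion of the Delannoy numbers. -/
theorem hermiteRatio_succ_sub (k i : ℕ) :
    hermiteRatio (k + 1) (i + 1) - hermiteRatio (k + 1) i =
      hermiteRatio k (i + 1) + hermiteRatio k i := by
  -- The recursion in `k` alone suffices: subtracting it at `i` from it at `i + 1` reduces the claim
  -- to the two preceding values of `k`.
  induction k using Nat.strong_induction_on with
  | _ k ih =>
    match k, ih with
    | 0, _ => simp only [hermiteRatio_zero, zero_add, hermiteRatio_one]; push_cast; ring
    | 1, _ =>
      have a := hermiteRatio_add_two 0 i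
      have b := hermiteRatio_add_two 0 (i + 1)
      simp only [hermiteRatio_zero, zero_add, hermiteRatio_one] at a b ⊢
      push_cast at a b ⊢
      linear_combination (b - a) / 2
    | k + 2, ih =>
      have h0 := ih k (by omega)
      have h1 := ih (k + 1) (by omega)
      have a := hermiteRatio_add_two (k + 1) i
      have b := hermiteRatio_add_two (k + 1) (i + 1)
      have c := hermiteRatio_add_two k i
      have d := hermiteRatio_add_two k (i + 1)
      push_cast at a b c d
      simp only [add_assoc, Nat.reduceAdd] at h0 h1 a b c d ⊢
      have hk : (k : ℂ) + 3 ≠ 0 := by exact_mod_cast Nat.succ_ne_zero (k + 2)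
      refine mul_left_cancel₀ hk ?_
      linear_combination b - a - c - d + (2 * (i : ℂ) + 2) * h1 + (k + 1) * h0

/-- By the Pascal rule the left side grows by `2 * hermiteRatio k n` when `n` grows by one; it
starts at zero because index 0 is the Gaussian itself. -/
theorem hermiteRatio_succ_sub_self (k n : ℕ) :
    hermiteRatio (k + 1) n - hermiteRatio k n = 2 * ∑ i ∈ Finset.range n, hermiteRatio k i := by
  induction n with
  | zero =>
    have h : ∀ k, hermiteRatio k 0 = 1 := by
      intro k
      rw [hermiteRatio, complexHermite_zero, one_pow, mul_one, Nat.factorial_zero, Nat.cast_one,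
        div_one, ← monomial_one_right_eq_X_pow, gaussExp_monomial, one_mul,
        div_self (gaussMoment_two_mul_ne_zero k)]
    simp [h]
  | succ n ih =>
    rw [Finset.sum_range_succ]
    linear_combination ih + hermiteRatio_succ_sub k n

/-- Here `N` enters the coefficients: the growth of `2 * N` contributes twice a partial sum, which
`hermiteRatio_succ_sub_self` rewrites as a difference, raising `k + 2` to `k + 3` on the left. -/
theorem sum_hermiteRatio_add_two (k N : ℕ) :
    ((k : ℂ) + 3) * ∑ i ∈ Finset.range N, hermiteRatio (k + 2) i =
      2 * N * ∑ i ∈ Finset.range N, hermiteRatio (k + 1) i +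
        (k + 1) * ∑ i ∈ Finset.range N, hermiteRatio k i := by
  induction N with
  | zero => simp
  | succ N ih =>
    simp only [Finset.sum_range_succ]
    push_cast
    linear_combination ih + hermiteRatio_add_two k N + hermiteRatio_succ_sub_self (k + 1) N

/-- The expected trace of the `2 * k`-th power of an unnormalized Gaussian matrix. -/
noncomputable def gueMoment (N k : ℕ) : ℂ := gueExp N (genericMatrix N ^ (2 * k)).trace

theorem gueMoment_zero (N : ℕ) : gueMoment N 0 = N := by
  rw [gueMoment, mul_zero, pow_zero, Matrix.trace_one, Fintype.card_fin, ← nsmul_one, map_nsmul,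
    gueExp_one, nsmul_one]

theorem gueMoment_eq {N : ℕ} (hN : N ≠ 0) (k : ℕ) :
    gueMoment N k = gaussMoment (2 * k) * ∑ i ∈ Finset.range N, hermiteRatio k i := by
  rw [gueMoment, gueExp_trace_pow hN, Finset.mul_sum]
  exact Finset.sum_congr rfl fun i _ => (mul_div_cancel₀ _ (gaussMoment_two_mul_ne_zero k)).symm

theorem gueMoment_one {N : ℕ} (hN : N ≠ 0) : gueMoment N 1 = (N : ℂ) ^ 2 := by
  have h : ∀ n : ℕ, ∑ i ∈ Finset.range n, (2 * (i : ℂ) + 1) = (n : ℂ) ^ 2 := by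
    intro n
    induction n with
    | zero => simp
    | succ n ih => rw [Finset.sum_range_succ, ih]; push_cast; ring
  rw [gueMoment_eq hN]
  simp only [hermiteRatio_one, h]
  simp [gaussMoment]

/-- The Harer-Zagier recursion for the moments of the Gaussian unitary ensemble. -/
theorem gueMoment_add_two {N : ℕ} (hN : N ≠ 0) (k : ℕ) :
    ((k : ℂ) + 3) * gueMoment N (k + 2) =
      2 * (2 * k + 3) * N * gueMoment N (k + 1) +
        (k + 1) * (2 * k + 3) * (2 * k + 1) * gueMoment N k := by
  have e1 := gaussMoment_two_mul_succ k
  have e2 := gaussMoment_two_mul_succ (k + 1)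
  rw [e1] at e2
  push_cast at e2
  have e2' : gaussMoment (2 * (k + 2)) = (2 * k + 3) * ((2 * k + 1) * gaussMoment (2 * k)) := by
    rw [e2]; ring
  rw [gueMoment_eq hN, gueMoment_eq hN, gueMoment_eq hN, e1, e2']
  linear_combination (2 * (k : ℂ) + 3) * (2 * k + 1) * gaussMoment (2 * k) *
    sum_hermiteRatio_add_two k N

end Recursion

/-! ### Wick's formula -/

section Wick

variable {N : ℕ} {T : Type*} [DecidableEq T]

/-- The pairings of the elements of `s` (extended by the identity) that match each index `v t` with
the transposed index. -/
def matchedPairings [Fintype T] (v : T → Fin N × Fin N) (s : Finset T) : Finset (Equiv.Perm T) :=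
  {π | (∀ t ∈ s, π (π t) = t ∧ π t ≠ t ∧ v (π t) = (v t).swap) ∧ ∀ t ∉ s, π t = t}

/-- Multiplication by the transposition of `a` and `t` removes the block they form, or restores it.
-/
theorem card_matchedPairings_fiber [Fintype T] (v : T → Fin N × Fin N) {s : Finset T}
    {a t : T} (ha : a ∈ s)
    (ht : t ∈ s.erase a) :
    ((matchedPairings v s).filter fun π => π a = t).card =
      if v t = (v a).swap then (matchedPairings v ((s.erase a).erase t)).card else 0 := by
  have hta : t ≠ a := Finset.ne_of_mem_erase ht
  have hts : t ∈ s := Finset.mem_of_mem_erase ht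
  split_ifs with hv
  · have hv' : v a = (v t).swap := by rw [hv, Prod.swap_swap]
    refine Finset.card_nbij' (fun π => Equiv.swap a t * π) (fun π => Equiv.swap a t * π)
      ?_ ?_ ?_ ?_
    · intro π hπ
      simp only [matchedPairings, Finset.coe_filter, Finset.mem_filter, Finset.mem_univ, true_and,
        Set.mem_ofPred_eq] at hπ ⊢
      obtain ⟨⟨h1, h2⟩, h3⟩ := hπ
      have h4 : π t = a := by rw [← h3]; exact (h1 a ha).1
      constructor
      · intro x hx
        simp only [Finset.mem_erase] at hx
        obtain ⟨hxt, hxa, hxs⟩ := hx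
        have h5 : π x ≠ a := fun h => hxt (π.injective (h.trans h4.symm))
        have h6 : π x ≠ t := fun h => hxa (π.injective (h.trans h3.symm))
        have h7 := h1 x hxs
        simp only [Equiv.Perm.mul_apply]
        rw [Equiv.swap_apply_of_ne_of_ne h5 h6, h7.1, Equiv.swap_apply_of_ne_of_ne hxa hxt]
        exact ⟨rfl, h7.2⟩
      · intro x hx
        rw [Equiv.Perm.mul_apply]
        by_cases hxa : x = a
        · rw [hxa, h3, Equiv.swap_apply_right]
        by_cases hxt : x = t
        · rw [hxt, h4, Equiv.swap_apply_left]
        have hxs : x ∉ s := fun h => hx (by simp [hxa, hxt, h])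
        rw [h2 x hxs, Equiv.swap_apply_of_ne_of_ne hxa hxt]
    · intro π hπ
      simp only [matchedPairings, Finset.coe_filter, Finset.mem_filter, Finset.mem_univ, true_and,
        Set.mem_ofPred_eq] at hπ ⊢
      obtain ⟨h1, h2⟩ := hπ
      have h3 : π a = a := h2 a (by simp)
      have h4 : π t = t := h2 t (by simp)
      have h5 : (Equiv.swap a t * π) a = t := by simp [h3]
      have h6 : (Equiv.swap a t * π) t = a := by simp [h4]
      refine ⟨⟨fun x hx => ?_, fun x hx => ?_⟩, h5⟩
      · by_cases hxa : x = a
        · rw [hxa, h5, h6]; exact ⟨rfl, hta, hv⟩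
        by_cases hxt : x = t
        · rw [hxt, h6, h5]; exact ⟨rfl, hta.symm, hv'⟩
        have h7 := h1 x (by simp [hxa, hxt, hx])
        have h8 : π x ≠ a := fun h => hxa (π.injective (h.trans h3.symm))
        have h9 : π x ≠ t := fun h => hxt (π.injective (h.trans h4.symm))
        simp only [Equiv.Perm.mul_apply]
        rw [Equiv.swap_apply_of_ne_of_ne h8 h9, h7.1, Equiv.swap_apply_of_ne_of_ne hxa hxt]
        exact ⟨rfl, h7.2⟩
      · have hxa : x ≠ a := fun h => hx (h ▸ ha)
        have hxt : x ≠ t := fun h => hx (h ▸ hts)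
        rw [Equiv.Perm.mul_apply, h2 x (by simp [hx]), Equiv.swap_apply_of_ne_of_ne hxa hxt]
    · intro π _; simp [← mul_assoc]
    · intro π _; simp [← mul_assoc]
  · rw [Finset.card_eq_zero, Finset.filter_eq_empty_iff]
    intro π hπ h
    simp only [matchedPairings, Finset.mem_filter, Finset.mem_univ, true_and] at hπ
    exact hv (h ▸ (hπ.1 a ha).2.2)

theorem pderiv_prod_X (v : T → Fin N × Fin N) (s : Finset T) (q : Fin N × Fin N) :
    MvPolynomial.pderiv q (∏ t ∈ s, MvPolynomial.X (v t) : MvPolynomial (Fin N × Fin N) ℂ) =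
      ∑ t ∈ s, if v t = q then ∏ r ∈ s.erase t, MvPolynomial.X (v r) else 0 := by
  induction s using Finset.induction_on with
  | empty => simp
  | insert a s ha ih =>
    rw [Finset.prod_insert ha, Derivation.leibniz, ih, MvPolynomial.pderiv_X,
      Finset.sum_insert ha, Finset.erase_insert ha, add_comm, smul_eq_mul, smul_eq_mul,
      Pi.single_apply, Finset.mul_sum]
    congr 1
    · simp [eq_comm]
    · refine Finset.sum_congr rfl fun t ht => ?_
      have hat : a ≠ t := fun h => ha (h ▸ ht)
      split_ifs
      · rw [Finset.erase_insert_of_ne hat,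
          Finset.prod_insert fun h => ha (Finset.mem_of_mem_erase h)]
      · simp

/-- Wick's formula. -/
theorem gueExp_prod_X [Fintype T] (v : T → Fin N × Fin N) (s : Finset T) :
    gueExp N (∏ t ∈ s, MvPolynomial.X (v t)) = (matchedPairings v s).card := by
  induction s using Finset.strongInduction with
  | H s ih =>
    rcases s.eq_empty_or_nonempty with rfl | ⟨a, ha⟩
    · have : matchedPairings v ∅ = {1} := by
        ext π
        simp [matchedPairings, Equiv.ext_iff]
      rw [this, Finset.prod_empty, gueExp_one]
      simp
    -- Integrating by parts in the factor at `a` sums over the factor `t` that is differentiated;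
    -- `t` is the partner of `a`.
    · rw [← Finset.mul_prod_erase _ _ ha, gueExp_X_mul, pderiv_prod_X, map_sum,
        Finset.card_eq_sum_card_fiberwise (f := fun π : Equiv.Perm T => π a) (t := s.erase a)]
      · push_cast
        refine Finset.sum_congr rfl fun t ht => ?_
        rw [card_matchedPairings_fiber v ha ht]
        split_ifs
        · refine ih _ ?_
          exact (Finset.erase_ssubset ht).trans (Finset.erase_ssubset ha)
        · simp
      · intro π hπ
        simp only [matchedPairings, Finset.coe_filter, Finset.mem_univ, true_and,
          Set.mem_ofPred_eq] at hπ
        have h1 := hπ.1 a ha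
        refine Finset.mem_coe.2 (Finset.mem_erase.2 ⟨h1.2.1, ?_⟩)
        by_contra h
        exact h1.2.1 (π.injective (hπ.2 _ h))

end Wick

/-! ### Traces of powers as sums over closed walks -/

section Trace

variable {ι R : Type*} [Fintype ι] [DecidableEq ι] [CommRing R]

theorem matrix_pow_succ_apply (M : Matrix ι ι R) (n : ℕ) (i j : ι) :
    (M ^ (n + 1)) i j = ∑ f : Fin n → ι, ∏ t : Fin (n + 1),
      M ((Fin.cons i f : Fin (n + 1) → ι) t) ((Fin.snoc f j : Fin (n + 1) → ι) t) := by
  induction n generalizing i with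
  | zero => simp [Fin.snoc]
  | succ n ih =>
    rw [pow_succ', Matrix.mul_apply, ← (Fin.consEquiv fun _ : Fin (n + 1) => ι).sum_comp,
      Fintype.sum_prod_type]
    refine Finset.sum_congr rfl fun k _ => ?_
    rw [ih, Finset.mul_sum]
    refine Finset.sum_congr rfl fun f _ => ?_
    change _ = ∏ t : Fin (n + 2), M ((Fin.cons i (Fin.cons k f) : Fin (n + 2) → ι) t)
      ((Fin.snoc (Fin.cons k f) j : Fin (n + 2) → ι) t)
    rw [Fin.prod_univ_succ (n := n + 1), ← Fin.cons_snoc_eq_snoc_cons]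
    simp only [Fin.cons_zero, Fin.cons_succ]

theorem trace_pow_succ_eq_sum (M : Matrix ι ι R) (n : ℕ) :
    (M ^ (n + 1)).trace =
      ∑ f : Fin (n + 1) → ι, ∏ t, M (f t) (f (finRotate (n + 1) t)) := by
  rw [← (Fin.consEquiv fun _ : Fin (n + 1) => ι).sum_comp, Fintype.sum_prod_type, Matrix.trace]
  refine Finset.sum_congr rfl fun i _ => ?_
  rw [Matrix.diag_apply, matrix_pow_succ_apply]
  refine Finset.sum_congr rfl fun f _ => Finset.prod_congr rfl fun t _ => ?_
  congr 1
  refine Fin.lastCases ?_ (fun u => ?_) t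
  · simp
  · simp

end Trace

/-! ### Counting index functions by cycles -/

section Cycles

theorem card_invariant_functions {n : ℕ} (σ : Equiv.Perm (Fin n)) (N : ℕ) :
    Fintype.card {f : Fin n → Fin N // ∀ t, f (σ t) = f t} = N ^ numCycles σ := by
  classical
  let e : {f : Fin n → Fin N // ∀ t, f (σ t) = f t} ≃
      (Quotient (Equiv.Perm.SameCycle.setoid σ) → Fin N) :=
    { toFun := fun f => Quotient.lift f.1 (by
        rintro a b ⟨k, rfl⟩
        have hz : ∀ (k : ℕ) (x : Fin n), f.1 ((σ ^ k) x) = f.1 x := by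
          intro k
          induction k with
          | zero => simp
          | succ k ih => intro x; rw [pow_succ', Equiv.Perm.mul_apply, f.2, ih]
        cases k with
        | ofNat k => simpa using (hz k a).symm
        | negSucc k =>
          have := hz (k + 1) ((σ ^ (k + 1))⁻¹ a)
          rw [Equiv.Perm.inv_def, Equiv.apply_symm_apply] at this
          rw [zpow_negSucc]
          exact this)
      invFun := fun g => ⟨fun t => g ⟦t⟧, fun t => congrArg g (Quotient.sound
        ((Equiv.Perm.sameCycle_apply_left).2 (Equiv.Perm.SameCycle.refl σ t)))⟩
      left_inv := fun f => rfl
      right_inv := fun g => by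
        ext q
        induction q using Quotient.inductionOn
        rfl }
  rw [Fintype.card_congr e, Fintype.card_fun, Fintype.card_fin, numCycles, Nat.card_eq_fintype_card]

open Classical in
/-- The pairings of `n` points, as a finite set. -/
noncomputable def pairingFinset (n : ℕ) : Finset (Equiv.Perm (Fin n)) :=
  Finset.univ.filter (· ∈ pairings n)

theorem mem_pairingFinset {n : ℕ} {π : Equiv.Perm (Fin n)} :
    π ∈ pairingFinset n ↔ π ∈ pairings n := by simp [pairingFinset]

/-- The genus expansion of the moments of the Gaussian unitary ensemble. -/
theorem gueMoment_eq_sum_pairings (N : ℕ) {k : ℕ} (hk : 1 ≤ k) :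
    gueMoment N k =
      ∑ π ∈ pairingFinset (2 * k), (N : ℂ) ^ numCycles (finRotate (2 * k) * π) := by
  classical
  obtain ⟨n, hn⟩ : ∃ n, 2 * k = n + 1 := ⟨2 * k - 1, by omega⟩
  rw [gueMoment, hn, trace_pow_succ_eq_sum, map_sum]
  have h1 : ∀ f : Fin (n + 1) → Fin N,
      gueExp N (∏ t, genericMatrix N (f t) (f (finRotate (n + 1) t))) =
        ∑ π ∈ pairingFinset (n + 1),
          if ∀ t, f ((finRotate (n + 1) * π) t) = f t then 1 else 0 := by
    intro f
    refine (gueExp_prod_X (fun t => (f t, f (finRotate (n + 1) t))) Finset.univ).trans ?_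
    rw [Finset.sum_boole]
    congr 2
    ext π
    refine Iff.trans ?_ Finset.mem_filter.symm
    rw [mem_pairingFinset]
    simp only [matchedPairings, Finset.mem_filter, Finset.mem_univ, true_and, not_true_eq_false,
      false_imp_iff, implies_true, and_true, pairings, Set.mem_ofPred_eq,
      forall_const, Prod.swap_prod_mk, Prod.mk.injEq, Equiv.Perm.mul_apply]
    constructor
    · exact fun h => ⟨fun t => ⟨(h t).1, (h t).2.1⟩, fun t => (h t).2.2.2⟩
    · intro h t
      -- Matching requires two index equations at `t`; the missing one is the invariance equation at
      -- `π t`.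
      refine ⟨(h.1 t).1, (h.1 t).2, ?_, h.2 t⟩
      have := h.2 (π t)
      rw [(h.1 t).1] at this
      exact this.symm
  rw [Finset.sum_congr rfl fun f _ => h1 f, Finset.sum_comm]
  refine Finset.sum_congr rfl fun π _ => ?_
  rw [Finset.sum_boole, ← Fintype.card_subtype, card_invariant_functions]
  push_cast
  rfl

end Cycles

/-! ### Parity in the dimension and existence of the genus -/

section Genus
open Polynomial

/-- The moments of the Gaussian unitary ensemble are polynomials in the dimension with a parity. -/
theorem exists_polynomial_gueMoment (k : ℕ) :
    ∃ H : ℂ[X], (∀ N : ℕ, N ≠ 0 → H.eval (N : ℂ) = gueMoment N k) ∧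
      ∀ j, H.coeff j ≠ 0 → ∃ g, j + 2 * g = k + 1 := by
  induction k using Nat.twoStepInduction with
  | zero =>
    refine ⟨X, fun N _ => by rw [eval_X, gueMoment_zero], fun j hj => ⟨0, ?_⟩⟩
    rw [coeff_X] at hj
    by_contra h
    exact hj (if_neg fun h' => h (by omega))
  | one =>
    refine ⟨X ^ 2, fun N hN => by rw [eval_pow, eval_X, gueMoment_one hN], fun j hj => ⟨0, ?_⟩⟩
    rw [coeff_X_pow] at hj
    by_contra h
    exact hj (if_neg fun h' => h (by omega))
  | more k ih0 ih1 =>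
    obtain ⟨H0, h0, c0⟩ := ih0
    obtain ⟨H1, h1, c1⟩ := ih1
    have hk : (k : ℂ) + 3 ≠ 0 := by exact_mod_cast Nat.succ_ne_zero (k + 2)
    -- The recursion solved for the new moment. The factor `X` keeps the genus of a term of `H1`,
    -- while a term of `H0` gains one genus.
    refine ⟨C (2 * (2 * k + 3) / ((k : ℂ) + 3)) * (X * H1) +
      C ((k + 1) * (2 * k + 3) * (2 * k + 1) / ((k : ℂ) + 3)) * H0, fun N hN => ?_, fun j hj => ?_⟩
    · have h := gueMoment_add_two hN k
      simp only [eval_add, eval_mul, eval_C, eval_X, h0 N hN, h1 N hN]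
      field_simp
      linear_combination -h
    · rw [coeff_add, coeff_C_mul, coeff_C_mul] at hj
      by_cases hj0 : H0.coeff j = 0
      · rw [hj0, mul_zero, add_zero] at hj
        have hj1 := right_ne_zero_of_mul hj
        cases j with
        | zero => simp at hj1
        | succ j =>
          rw [coeff_X_mul] at hj1
          obtain ⟨g, hg⟩ := c1 j hj1
          exact ⟨g, by omega⟩
      · obtain ⟨g, hg⟩ := c0 j hj0
        exact ⟨g + 1, by omega⟩

/-- Every pairing has a genus. -/
theorem exists_genus {k : ℕ} (hk : 1 ≤ k) {π : Equiv.Perm (Fin (2 * k))}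
    (hπ : π ∈ pairings (2 * k)) :
    ∃ g, numCycles (finRotate (2 * k) * π) + 2 * g = k + 1 := by
  obtain ⟨H, hH, hc⟩ := exists_polynomial_gueMoment k
  have hP : ∑ σ ∈ pairingFinset (2 * k), (X : ℂ[X]) ^ numCycles (finRotate (2 * k) * σ) = H := by
    refine Polynomial.eq_of_infinite_eval_eq _ _ ?_
    refine Set.Infinite.mono ?_ (Set.infinite_range_of_injective
      (f := fun n : ℕ => ((n + 1 : ℕ) : ℂ)) fun a b h => by simpa using h)
    rintro _ ⟨n, rfl⟩
    rw [Set.mem_ofPred_eq, hH _ (Nat.succ_ne_zero n), gueMoment_eq_sum_pairings _ hk,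
      eval_finsetSum]
    simp
  refine hc _ ?_
  -- The coefficient counts pairings, so nothing cancels: it is nonzero as soon as one pairing, here
  -- `π`, has that number of cycles.
  rw [← hP, finsetSum_coeff]
  simp only [coeff_X_pow]
  rw [Finset.sum_boole]
  refine Nat.cast_ne_zero.2 (Finset.card_ne_zero_of_mem (a := π) ?_)
  exact Finset.mem_filter.2 ⟨mem_pairingFinset.2 hπ, rfl⟩

theorem pow_mul_genusSum {N k : ℕ} (hN : N ≠ 0) (hk : 1 ≤ k) :
    (N : ℝ) ^ (k + 1) * genusSum N k =
      ∑ π ∈ pairingFinset (2 * k), (N : ℝ) ^ numCycles (finRotate (2 * k) * π) := by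
  classical
  have hN' : (N : ℝ) ≠ 0 := Nat.cast_ne_zero.2 hN
  have h1 : ∀ g, (genusCount g k : ℝ) =
      ∑ π ∈ pairingFinset (2 * k), if HasGenus k π g then 1 else 0 := by
    intro g
    rw [Finset.sum_boole, genusCount, ← Set.ncard_coe_finset]
    congr 2
    ext π
    simp [mem_pairingFinset]
  rw [genusSum]
  simp only [h1, Finset.sum_mul, Finset.mul_sum]
  rw [Finset.sum_comm]
  refine Finset.sum_congr rfl fun π hπ => ?_
  obtain ⟨g, hg⟩ := exists_genus hk (mem_pairingFinset.1 hπ)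
  rw [Finset.sum_eq_single g]
  · have : HasGenus k π g := by unfold HasGenus; omega
    rw [if_pos this, one_mul, ← hg, pow_add, neg_mul, zpow_neg, mul_assoc]
    have e : (N : ℝ) ^ (2 * (g : ℤ)) = (N : ℝ) ^ (2 * g) := by
      rw [← zpow_natCast]; push_cast; rfl
    rw [e, mul_inv_cancel₀ (pow_ne_zero _ hN'), mul_one]
  · intro g' _ hne
    rw [if_neg, zero_mul, mul_zero]
    intro h
    unfold HasGenus at h
    omega
  · intro h
    exact absurd (Finset.mem_range.2 (by omega)) h

theorem gueMoment_eq_genusSum {N k : ℕ} (hN : N ≠ 0) (hk : 1 ≤ k) :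
    gueMoment N k = (((N : ℝ) ^ (k + 1) * genusSum N k : ℝ) : ℂ) := by
  rw [pow_mul_genusSum hN hk, gueMoment_eq_sum_pairings _ hk]
  push_cast
  rfl

end Genus

/-! ### Moments of the real and complex Gaussian laws -/

section Gaussian

theorem integrable_pow_gaussianReal (n : ℕ) :
    Integrable (fun x : ℝ => x ^ n) (gaussianReal 0 1) := by
  have h := (memLp_id_gaussianReal (μ := 0) (v := 1) n).integrable_norm_pow'
  simp only [id_eq, ← norm_pow] at h
  exact (integrable_norm_iff (by fun_prop)).1 h

theorem hasDerivAt_gaussianPDFReal (x : ℝ) :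
    HasDerivAt (gaussianPDFReal 0 1) (-x * gaussianPDFReal 0 1 x) x := by
  have h : HasDerivAt (fun y : ℝ => -(y - 0) ^ 2 / (2 * ((1 : NNReal) : ℝ))) (-x) x := by
    have := (((hasDerivAt_id x).sub_const 0).pow 2).neg.div_const (2 * ((1 : NNReal) : ℝ))
    refine this.congr_deriv ?_
    simp; ring
  rw [gaussianPDFReal_def]
  refine (h.exp.const_mul _).congr_deriv ?_
  ring

theorem integrable_gaussianPDFReal_mul_pow (n : ℕ) :
    Integrable (fun x : ℝ => gaussianPDFReal 0 1 x * x ^ n) := by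
  have h := integrable_pow_gaussianReal n
  rw [gaussianReal_of_var_ne_zero _ one_ne_zero, integrable_withDensity_iff_integrable_smul'
    (measurable_gaussianPDF 0 1) (ae_of_all _ fun _ => gaussianPDF_lt_top)] at h
  simpa using h

theorem integral_pow_add_two_gaussianReal (n : ℕ) :
    ∫ x, x ^ (n + 2) ∂(gaussianReal 0 1) = (n + 1) * ∫ x, x ^ n ∂(gaussianReal 0 1) := by
  simp only [integral_gaussianReal_eq_integral_smul (one_ne_zero : (1 : NNReal) ≠ 0), smul_eq_mul]
  have h := integral_mul_deriv_eq_deriv_mul_of_integrable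
    (u := fun x : ℝ => x ^ (n + 1)) (v := gaussianPDFReal 0 1)
    (u' := fun x : ℝ => (n + 1) * x ^ n) (v' := fun x => -x * gaussianPDFReal 0 1 x)
    (fun x _ => (hasDerivAt_pow (n + 1) x).congr_deriv (by simp))
    (fun x _ => hasDerivAt_gaussianPDFReal x)
    ((integrable_gaussianPDFReal_mul_pow (n + 2)).neg.congr
      (ae_of_all _ fun x => by simp only [Pi.neg_apply, Pi.mul_apply]; ring))
    (((integrable_gaussianPDFReal_mul_pow n).const_mul ((n : ℝ) + 1)).congr
      (ae_of_all _ fun x => by simp only [Pi.mul_apply]; ring))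
    ((integrable_gaussianPDFReal_mul_pow (n + 1)).congr
      (ae_of_all _ fun x => by simp only [Pi.mul_apply]; ring))
  rw [← integral_const_mul]
  have e1 : ∀ x : ℝ, gaussianPDFReal 0 1 x * x ^ (n + 2) =
      -(x ^ (n + 1) * (-x * gaussianPDFReal 0 1 x)) := fun x => by ring
  have e2 : ∀ x : ℝ, ((n : ℝ) + 1) * (gaussianPDFReal 0 1 x * x ^ n) =
      (n + 1) * x ^ n * gaussianPDFReal 0 1 x := fun x => by ring
  simp only [e1, e2, integral_neg, h, neg_neg]

theorem integral_pow_gaussianReal (n : ℕ) :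
    ((∫ x, x ^ n ∂(gaussianReal 0 1) : ℝ) : ℂ) = gaussMoment n := by
  induction n using Nat.twoStepInduction with
  | zero => simp [gaussMoment]
  | one => simp [gaussMoment]
  | more n ih _ =>
    rw [integral_pow_add_two_gaussianReal, gaussMoment, ← ih]
    push_cast
    rfl

theorem integrable_ofReal_pow_gaussianReal (n : ℕ) :
    Integrable (fun x : ℝ => (x : ℂ) ^ n) (gaussianReal 0 1) := by
  simpa using! (integrable_pow_gaussianReal n).ofReal (𝕜 := ℂ)

theorem integral_ofReal_pow_gaussianReal (n : ℕ) :
    ∫ x, (x : ℂ) ^ n ∂(gaussianReal 0 1) = gaussMoment n := by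
  rw [← integral_pow_gaussianReal, ← integral_complex_ofReal]
  simp

theorem integrable_pow_stdRealGaussian (n : ℕ) :
    Integrable (fun z : ℂ => z ^ n) stdRealGaussian := by
  rw [stdRealGaussian, integrable_map_measure (by fun_prop) (by fun_prop)]
  exact integrable_ofReal_pow_gaussianReal n

theorem integral_pow_stdRealGaussian (n : ℕ) :
    ∫ z, z ^ n ∂stdRealGaussian = gaussMoment n := by
  rw [stdRealGaussian, integral_map (by fun_prop) (by fun_prop)]
  exact integral_ofReal_pow_gaussianReal n

theorem integral_eval_gaussian_prod (F : MvPolynomial (Fin 2) ℂ) :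
    Integrable (fun p : ℝ × ℝ => MvPolynomial.eval ![(p.1 : ℂ), (p.2 : ℂ)] F)
      ((gaussianReal 0 1).prod (gaussianReal 0 1)) ∧
    ∫ p : ℝ × ℝ, MvPolynomial.eval ![(p.1 : ℂ), (p.2 : ℂ)] F
      ∂((gaussianReal 0 1).prod (gaussianReal 0 1)) = gaussExpPi 2 F := by
  induction F using MvPolynomial.induction_on' with
  | monomial m c =>
    have h : ∀ p : ℝ × ℝ, MvPolynomial.eval ![(p.1 : ℂ), (p.2 : ℂ)] (MvPolynomial.monomial m c) =
        c * ((p.1 : ℂ) ^ m 0 * (p.2 : ℂ) ^ m 1) := by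
      intro p
      rw [MvPolynomial.eval_monomial, Finsupp.prod_fintype _ _ (by simp)]
      simp
    simp only [h]
    constructor
    · exact ((integrable_ofReal_pow_gaussianReal (m 0)).mul_prod
        (integrable_ofReal_pow_gaussianReal (m 1))).const_mul c
    · rw [integral_const_mul, integral_prod_mul (fun x : ℝ => (x : ℂ) ^ m 0)
        (fun x : ℝ => (x : ℂ) ^ m 1), integral_ofReal_pow_gaussianReal,
        integral_ofReal_pow_gaussianReal, gaussExpPi, monomialFunctional_monomial]
      simp
  | add p q hp hq =>
    simp only [map_add]
    exact ⟨hp.1.add hq.1, by rw [integral_add hp.1 hq.1, hp.2, hq.2]⟩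

open MvPolynomial in
/-- The derivation that replaces multiplication by `r * (X + s * Y)` under the expectation. -/
noncomputable def linearFormDerivation (r s : ℂ) :
    Derivation ℂ (MvPolynomial (Fin 2) ℂ) (MvPolynomial (Fin 2) ℂ) :=
  (C r : MvPolynomial (Fin 2) ℂ) • pderiv 0 + (C r * C s : MvPolynomial (Fin 2) ℂ) • pderiv 1

open MvPolynomial in
/-- The moments of `(X + iY) / √2`, where `r` stands for `1 / √2`. -/
theorem gaussExpPi_complex {r : ℂ} (hr : 2 * r ^ 2 = 1) (p q : ℕ) :
    gaussExpPi 2 ((C r * (X 0 + C Complex.I * X 1)) ^ p * (C r * (X 0 - C Complex.I * X 1)) ^ q) =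
      if p = q then (p.factorial : ℂ) else 0 := by
  set z : MvPolynomial (Fin 2) ℂ := C r * (X 0 + C Complex.I * X 1) with hz
  set w : MvPolynomial (Fin 2) ℂ := C r * (X 0 - C Complex.I * X 1) with hw
  have hI : (C Complex.I : MvPolynomial (Fin 2) ℂ) * C Complex.I = -1 := by
    rw [← C_mul, Complex.I_mul_I]; simp
  have hrr : (2 : MvPolynomial (Fin 2) ℂ) * (C r * C r) = 1 := by
    rw [← C_mul, ← pow_two, ← C_1, ← hr, C_mul, map_ofNat]
  have hX : ∀ i j : Fin 2, pderiv i (X j : MvPolynomial (Fin 2) ℂ) = if i = j then 1 else 0 := by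
    intro i j; rw [pderiv_X, Pi.single_apply]; simp [eq_comm]
  have stein : ∀ (s : ℂ) (f : MvPolynomial (Fin 2) ℂ),
      gaussExpPi 2 (C r * (X 0 + C s * X 1) * f) =
        gaussExpPi 2 (linearFormDerivation r s f) := by
    intro s f
    have e : C r * (X 0 + C s * X 1) * f = r • (X 0 * f) + (r * s) • (X 1 * f) := by
      rw [smul_eq_C_mul, smul_eq_C_mul, C_mul]; ring
    rw [e, map_add, map_smul, map_smul, gaussExpPi_X_mul, gaussExpPi_X_mul,
      ← (gaussExpPi 2).map_smul, ← (gaussExpPi 2).map_smul, ← map_add,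
      smul_eq_C_mul, smul_eq_C_mul, C_mul]
    simp [linearFormDerivation]
  -- Integration by parts in `w` is a derivation that kills `w`, since `1 + I ^ 2 = 0`.
  have hwz : ∀ n, gaussExpPi 2 (w ^ (n + 1)) = 0 := by
    intro n
    have e : w ^ (n + 1) = C r * (X 0 + C (-Complex.I) * X 1) * w ^ n := by
      rw [pow_succ', hw, C_neg]; ring
    have hd : linearFormDerivation r (-Complex.I) w = 0 := by
      simp only [hw, linearFormDerivation, Derivation.add_apply,
        Derivation.smul_apply, Derivation.leibniz, map_sub, hX,
        smul_eq_mul, pderiv_C, C_neg]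
      simp
      right
      linear_combination C r * hI
    rw [e, stein, Derivation.leibniz_pow, hd]
    simp
  have hdz : linearFormDerivation r Complex.I z = 0 := by
    simp only [hz, linearFormDerivation, Derivation.add_apply,
        Derivation.smul_apply, Derivation.leibniz, map_add, hX,
      smul_eq_mul, pderiv_C]
    simp
    right
    linear_combination C r * hI
  -- With `hdz`, the derivation attached to `z` acts as the derivative in `w`; each integration by
  -- parts lowers both exponents by one.
  have hdw : linearFormDerivation r Complex.I w = 1 := by
    simp only [hw, linearFormDerivation, Derivation.add_apply,
        Derivation.smul_apply, Derivation.leibniz, map_sub, hX,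
      smul_eq_mul, pderiv_C]
    simp
    linear_combination - C r * C r * hI + hrr
  have h1 : gaussExpPi 2 (1 : MvPolynomial (Fin 2) ℂ) = 1 := by
    have := gaussExpPi_prod (N := 2) (fun _ => 1)
    have h0 := gaussExp_complexHermite_mul 0 0
    simp only [complexHermite_zero, mul_one] at h0
    simpa [h0] using this
  induction p generalizing q with
  | zero =>
    cases q with
    | zero => simp [h1]
    | succ q => rw [pow_zero, one_mul, hwz]; simp
  | succ p ih =>
    have e : z ^ (p + 1) * w ^ q = C r * (X 0 + C Complex.I * X 1) * (z ^ p * w ^ q) := by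
      rw [pow_succ', hz]; ring
    rw [e, stein, Derivation.leibniz, Derivation.leibniz_pow, Derivation.leibniz_pow, hdz, hdw]
    cases q with
    | zero => simp
    | succ q =>
      have e2 : z ^ p • (q + 1) • w ^ (q + 1 - 1) • (1 : MvPolynomial (Fin 2) ℂ) +
          w ^ (q + 1) • p • z ^ (p - 1) • (0 : MvPolynomial (Fin 2) ℂ) =
            (q + 1) • (z ^ p * w ^ q) := by
        simp
        ring
      rw [e2, map_nsmul, ih]
      by_cases h : p = q
      · subst h
        simp [Nat.factorial_succ]
      · simp [h]

open MvPolynomial in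
theorem integral_pow_stdComplexGaussian (p q : ℕ) :
    Integrable (fun z : ℂ => z ^ p * (starRingEnd ℂ z) ^ q) stdComplexGaussian ∧
    ∫ z, z ^ p * (starRingEnd ℂ z) ^ q ∂stdComplexGaussian =
      if p = q then (p.factorial : ℂ) else 0 := by
  have hr : 2 * ((Real.sqrt 2 : ℂ)⁻¹) ^ 2 = 1 := by
    rw [inv_pow, ← Complex.ofReal_pow, Real.sq_sqrt (by norm_num)]
    norm_num
  have h := integral_eval_gaussian_prod
    ((C (Real.sqrt 2 : ℂ)⁻¹ * (X 0 + C Complex.I * X 1)) ^ p *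
      (C (Real.sqrt 2 : ℂ)⁻¹ * (X 0 - C Complex.I * X 1)) ^ q)
  rw [gaussExpPi_complex hr] at h
  have e : ∀ x : ℝ × ℝ, eval ![(x.1 : ℂ), (x.2 : ℂ)]
      ((C (Real.sqrt 2 : ℂ)⁻¹ * (X 0 + C Complex.I * X 1)) ^ p *
        (C (Real.sqrt 2 : ℂ)⁻¹ * (X 0 - C Complex.I * X 1)) ^ q) =
      (((x.1 : ℂ) + Complex.I * (x.2 : ℂ)) / (Real.sqrt 2 : ℂ)) ^ p *
        (starRingEnd ℂ (((x.1 : ℂ) + Complex.I * (x.2 : ℂ)) / (Real.sqrt 2 : ℂ))) ^ q := by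
    intro x
    simp [div_eq_inv_mul, sub_eq_add_neg]
  simp only [e] at h
  have hm : AEMeasurable (fun x : ℝ × ℝ =>
      ((x.1 : ℂ) + Complex.I * (x.2 : ℂ)) / (Real.sqrt 2 : ℂ))
      ((gaussianReal 0 1).prod (gaussianReal 0 1)) := by fun_prop
  have hc : Continuous (fun z : ℂ => z ^ p * (starRingEnd ℂ z) ^ q) :=
    (continuous_id.pow p).mul (Complex.continuous_conj.pow q)
  rw [stdComplexGaussian, integrable_map_measure hc.aestronglyMeasurable hm,
    integral_map hm hc.aestronglyMeasurable]
  exact h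

end Gaussian

/-! ### From the formal functional to the random matrix -/

section Expectation

variable {N : ℕ}

/-- Each entry above the diagonal is grouped with its transpose, because only the entries on or
below the diagonal are independent. -/
theorem prod_eq_prod_lowerIndex (G : Fin N × Fin N → ℂ) :
    ∏ q, G q = ∏ p : LowerIndex N, if p.1.1 = p.1.2 then G p.1 else G p.1 * G p.1.swap := by
  have h1 : ∏ p : LowerIndex N, (if p.1.1 = p.1.2 then G p.1 else G p.1 * G p.1.swap) =
      ∏ q : Fin N × Fin N with q.2 ≤ q.1, G q * if q.1 = q.2 then 1 else G q.swap := by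
    rw [Finset.prod_subtype (p := fun q : Fin N × Fin N => q.2 ≤ q.1) _ (by simp)]
    refine Finset.prod_congr rfl fun p _ => ?_
    split_ifs <;> simp
  rw [h1, Finset.prod_mul_distrib,
    ← Finset.prod_filter_mul_prod_filter_not Finset.univ fun q : Fin N × Fin N => q.2 ≤ q.1]
  congr 1
  symm
  rw [Finset.prod_ite, Finset.prod_const_one, one_mul, Finset.filter_filter]
  refine Finset.prod_nbij' Prod.swap Prod.swap ?_ ?_ ?_ ?_ ?_
  · rintro ⟨i, j⟩ h
    simp only [Finset.mem_filter, Finset.mem_univ, true_and, Prod.swap_prod_mk, not_le] at h ⊢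
    exact lt_of_le_of_ne h.1 fun e => h.2 e.symm
  · rintro ⟨i, j⟩ h
    simp only [Finset.mem_filter, Finset.mem_univ, true_and, Prod.swap_prod_mk, not_le] at h ⊢
    exact ⟨h.le, h.ne'⟩
  · simp
  · simp
  · simp

variable {Ω : Type*} [MeasurableSpace Ω] {P : Measure Ω}
  {a : Ω → Matrix (Fin N) (Fin N) ℂ}

/-- The factor that an entry on or below the diagonal contributes to a monomial, given that the
matrix is selfadjoint. -/
noncomputable def entryFactor (m : Fin N × Fin N →₀ ℕ) (p : LowerIndex N) (z : ℂ) : ℂ :=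
  if p.1.1 = p.1.2 then z ^ m p.1 else z ^ m p.1 * (starRingEnd ℂ z) ^ m p.1.swap

theorem continuous_entryFactor (m : Fin N × Fin N →₀ ℕ) (p : LowerIndex N) :
    Continuous (entryFactor m p) := by
  unfold entryFactor
  split_ifs
  · exact continuous_id.pow _
  · exact (continuous_id.pow _).mul (Complex.continuous_conj.pow _)

theorem IsUnnormalizedGUE.aemeasurable (ha : IsUnnormalizedGUE P a) (i j : Fin N) :
    AEMeasurable (fun ω => a ω i j) P := by
  by_cases h : i = j
  · subst h; exact (ha.law_diag i).aemeasurable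
  · exact (ha.law_offDiag i j h).aemeasurable

theorem IsUnnormalizedGUE.integral_entryFactor (ha : IsUnnormalizedGUE P a)
    (m : Fin N × Fin N →₀ ℕ) (p : LowerIndex N) :
    Integrable (entryFactor m p) (P.map fun ω => a ω p.1.1 p.1.2) ∧
      ∫ z, entryFactor m p z ∂(P.map fun ω => a ω p.1.1 p.1.2) = entryMoment m p := by
  unfold entryFactor entryMoment
  obtain ⟨⟨i, j⟩, hp⟩ := p
  dsimp only
  split_ifs with h h'
  · subst h
    rw [(ha.law_diag i).map_eq]
    exact ⟨integrable_pow_stdRealGaussian _, integral_pow_stdRealGaussian _⟩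
  · rw [(ha.law_offDiag i j h).map_eq]
    have := integral_pow_stdComplexGaussian (m (i, j)) (m (Prod.swap (i, j)))
    rwa [if_pos h'] at this
  · rw [(ha.law_offDiag i j h).map_eq]
    have := integral_pow_stdComplexGaussian (m (i, j)) (m (Prod.swap (i, j)))
    rwa [if_neg h'] at this

/-- Selfadjointness makes a monomial almost surely a product of functions of single lower entries;
independence then factors both integrability and expectation. -/
theorem IsUnnormalizedGUE.integral_eval [IsProbabilityMeasure P] (ha : IsUnnormalizedGUE P a)
    (f : MvPolynomial (Fin N × Fin N) ℂ) :
    Integrable (fun ω => MvPolynomial.eval (fun q => a ω q.1 q.2) f) P ∧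
      ∫ ω, MvPolynomial.eval (fun q => a ω q.1 q.2) f ∂P = gueExp N f := by
  induction f using MvPolynomial.induction_on' with
  | monomial m c =>
    have h : (fun ω => MvPolynomial.eval (fun q => a ω q.1 q.2) (MvPolynomial.monomial m c)) =ᵐ[P]
        fun ω => c * ∏ p : LowerIndex N, entryFactor m p (a ω p.1.1 p.1.2) := by
      filter_upwards [ha.isHermitian] with ω hω
      rw [MvPolynomial.eval_monomial, Finsupp.prod_fintype _ _ (by simp), prod_eq_prod_lowerIndex]
      congr 1
      refine Finset.prod_congr rfl fun p _ => ?_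
      rw [entryFactor, starRingEnd_apply, hω.apply]
      rfl
    have hm : ∀ p : LowerIndex N, AEMeasurable (fun ω => a ω p.1.1 p.1.2) P :=
      fun p => ha.aemeasurable _ _
    have hprob : ∀ p : LowerIndex N,
        IsProbabilityMeasure (P.map fun ω => a ω p.1.1 p.1.2) :=
      fun p => Measure.isProbabilityMeasure_map (hm p)
    have hc : Continuous fun x : LowerIndex N → ℂ => ∏ p, entryFactor m p (x p) :=
      continuous_finsetProd _ fun p _ => (continuous_entryFactor m p).comp (continuous_apply p)
    have hint : Integrable (fun ω => ∏ p : LowerIndex N, entryFactor m p (a ω p.1.1 p.1.2)) P := by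
      have h1 := Integrable.fintype_prod_dep (𝕜 := ℂ)
        (f := fun p : LowerIndex N => entryFactor m p)
        (μ := fun p : LowerIndex N => P.map fun ω => a ω p.1.1 p.1.2)
        fun p => (ha.integral_entryFactor m p).1
      rw [← ha.indep.map_fun_eq_pi_map hm, integrable_map_measure hc.aestronglyMeasurable
        (aemeasurable_pi_lambda _ hm)] at h1
      exact h1
    refine ⟨(hint.const_mul c).congr h.symm, ?_⟩
    rw [integral_congr_ae h, integral_const_mul, gueExp, monomialFunctional_monomial,
      ha.indep.integral_fun_prod_comp hm
        fun p => (continuous_entryFactor m p).aestronglyMeasurable]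
    congr 1
    refine Finset.prod_congr rfl fun p _ => ?_
    rw [← (ha.integral_entryFactor m p).2,
      integral_map (hm p) (continuous_entryFactor m p).aestronglyMeasurable]
  | add p q hp hq =>
    simp only [map_add]
    exact ⟨hp.1.add hq.1, by rw [integral_add hp.1 hq.1, hp.2, hq.2]⟩

theorem eval_trace_genericMatrix_pow (M : Matrix (Fin N) (Fin N) ℂ) (n : ℕ) :
    MvPolynomial.eval (fun q => M q.1 q.2) (genericMatrix N ^ n).trace = (M ^ n).trace := by
  have h : (MvPolynomial.eval fun q => M q.1 q.2).mapMatrix (genericMatrix N) = M := by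
    ext i j
    simp [genericMatrix]
  conv_rhs => rw [← h, ← map_pow]
  simp [Matrix.trace]

theorem IsUnnormalizedGUE.integral_trace_pow [IsProbabilityMeasure P]
    (ha : IsUnnormalizedGUE P a) (k : ℕ) :
    Integrable (fun ω => (a ω ^ (2 * k)).trace) P ∧
      ∫ ω, (a ω ^ (2 * k)).trace ∂P = gueMoment N k := by
  have h := ha.integral_eval (genericMatrix N ^ (2 * k)).trace
  simp only [eval_trace_genericMatrix_pow] at h
  exact h

theorem normTrace_smul_pow (hN : N ≠ 0) (M : Matrix (Fin N) (Fin N) ℂ) (k : ℕ) :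
    normTrace (((1 / (Real.sqrt N : ℂ)) • M) ^ (2 * k)) =
      ((N : ℂ) ^ (k + 1))⁻¹ * (M ^ (2 * k)).trace := by
  have hs : (Real.sqrt N : ℂ) ^ 2 = N := by
    rw [← Complex.ofReal_pow, Real.sq_sqrt (Nat.cast_nonneg N), Complex.ofReal_natCast]
  have hN' : (N : ℂ) ≠ 0 := Nat.cast_ne_zero.2 hN
  rw [normTrace, smul_pow, Matrix.trace_smul, smul_eq_mul, pow_mul (1 / _), div_pow, hs, one_pow,
    one_div, inv_pow]
  field_simp
  ring

end Expectation

/-! ### Catalan ratios and conclusion -/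

theorem catalan_recursion (k : ℕ) :
    ((k : ℝ) + 2) * catalan (k + 1) = 2 * (2 * k + 1) * catalan k := by
  have h1 := succ_mul_catalan_eq_centralBinom k
  have h2 := succ_mul_catalan_eq_centralBinom (k + 1)
  have h3 := Nat.succ_mul_centralBinom_succ k
  rw [← h1, ← h2] at h3
  have h4 : ((k : ℝ) + 1) * (((k : ℝ) + 1 + 1) * catalan (k + 1)) =
      2 * (2 * k + 1) * ((k + 1) * catalan k) := by exact_mod_cast h3
  have hk : (k : ℝ) + 1 ≠ 0 := by positivity
  refine mul_left_cancel₀ hk ?_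
  linear_combination h4

end HarerZagier

theorem theorem9p2 (N : ℕ) (hN : 1 ≤ N) (b : ℕ → ℝ) (hb_zero : b 0 = 1)
    (hb : ∀ k : ℕ, 1 ≤ k → HarerZagier.genusSum N k = (catalan k : ℝ) * b k) :
    (∀ {Ω : Type*} [MeasurableSpace Ω] (P : Measure Ω) [IsProbabilityMeasure P]
      (A : Ω → Matrix (Fin N) (Fin N) ℂ), HarerZagier.IsGUE P A → ∀ k : ℕ,
        Integrable (fun ω => HarerZagier.normTrace (A ω ^ (2 * k))) P ∧
        ∫ ω, HarerZagier.normTrace (A ω ^ (2 * k)) ∂P = (((catalan k : ℝ) * b k : ℝ) : ℂ)) ∧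
    (∀ k : ℕ, 1 ≤ k →
      b (k + 1) = b k + (k : ℝ) * ((k : ℝ) + 1) / (4 * (N : ℝ) ^ 2) * b (k - 1)) := by
  have hN0 : N ≠ 0 := Nat.one_le_iff_ne_zero.1 hN
  have hNC : (N : ℂ) ≠ 0 := Nat.cast_ne_zero.2 hN0
  have hNR : (N : ℝ) ≠ 0 := Nat.cast_ne_zero.2 hN0
  have hT : ∀ k, HarerZagier.gueMoment N k =
      (((N : ℝ) ^ (k + 1) * ((catalan k : ℝ) * b k) : ℝ) : ℂ) := by
    intro k
    -- The genus expansion starts at `k = 1`; at `k = 0` the trace is `N` and `b 0 = 1`.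
    rcases Nat.eq_zero_or_pos k with rfl | hk
    · simp [HarerZagier.gueMoment_zero, hb_zero]
    · rw [HarerZagier.gueMoment_eq_genusSum hN0 hk, hb k hk]
  constructor
  · rintro Ω _ P _ A ⟨a, ha, hA⟩ k
    obtain ⟨h1, h2⟩ := ha.integral_trace_pow k
    simp only [hA, HarerZagier.normTrace_smul_pow hN0]
    refine ⟨h1.const_mul _, ?_⟩
    rw [integral_const_mul, h2, hT, Complex.ofReal_mul, Complex.ofReal_pow, Complex.ofReal_natCast,
      inv_mul_cancel_left₀ (pow_ne_zero _ hNC)]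
  · intro k hk
    obtain ⟨k, rfl⟩ : ∃ l, k = l + 1 := ⟨k - 1, by omega⟩
    have h := HarerZagier.gueMoment_add_two hN0 k
    rw [hT, hT, hT] at h
    have h' : ((k : ℝ) + 3) * ((N : ℝ) ^ (k + 2 + 1) * ((catalan (k + 2) : ℝ) * b (k + 2))) =
        2 * (2 * k + 3) * N * ((N : ℝ) ^ (k + 1 + 1) * ((catalan (k + 1) : ℝ) * b (k + 1))) +
          (k + 1) * (2 * k + 3) * (2 * k + 1) *
            ((N : ℝ) ^ (k + 1) * ((catalan k : ℝ) * b k)) := by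
      exact_mod_cast h
    have c1 := HarerZagier.catalan_recursion k
    have c2 := HarerZagier.catalan_recursion (k + 1)
    push_cast at c2
    have hc : (catalan k : ℝ) ≠ 0 := by
      have := succ_mul_catalan_eq_centralBinom k
      have h0 := Nat.centralBinom_ne_zero k
      exact Nat.cast_ne_zero.2 fun e => h0 (by rw [← this, e, mul_zero])
    have hk2 : (k : ℝ) + 2 ≠ 0 := by positivity
    have hk1 : 2 * (k : ℝ) + 1 ≠ 0 := by positivity
    have hk3 : 2 * (k : ℝ) + 3 ≠ 0 := by positivity
    -- `e2` gives both `b (k + 2)` and `b (k + 1)` the coefficient `2 * (2 * k + 3) * catalan (k +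
    -- 1)`, up to equal powers of `N`; `e1` leaves `(k + 1) * (k + 2) / (4 * N ^ 2)` on `b k`.
    have e1 : (catalan (k + 1) : ℝ) = 2 * (2 * k + 1) * catalan k / (k + 2) := by
      rw [eq_div_iff hk2]; linear_combination c1
    have e2 : ((k : ℝ) + 3) * catalan (k + 2) = 2 * (2 * k + 3) * catalan (k + 1) := by
      linear_combination c2
    have e3 : ((k : ℝ) + 3) * ((N : ℝ) ^ (k + 2 + 1) * ((catalan (k + 2) : ℝ) * b (k + 2))) =
        (N : ℝ) ^ (k + 2 + 1) * (2 * (2 * k + 3) * catalan (k + 1)) * b (k + 2) := by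
      rw [← e2]; ring
    rw [e3, e1] at h'
    have hp : (N : ℝ) ^ (k + 1) ≠ 0 := pow_ne_zero _ hNR
    have key : 4 * (N : ℝ) ^ 2 * b (k + 2) = 4 * (N : ℝ) ^ 2 * b (k + 1) +
        (k + 1) * (k + 2) * b k := by
      refine mul_left_cancel₀ hp ?_
      field_simp at h'
      linear_combination h'
    rw [Nat.add_sub_cancel]
    push_cast
    field_simp
    linear_combination key
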